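/- Let $\mathbb H^1=\mathbb R^3$ with coordinates $(x,y,z)$, $r=\sqrt{x^2+y^2}$, vector fields $X=\partial_x-\frac y2\partial_z$, $Y=\partial_y+\frac x2\partial_z$, contact form $\omega=dz-\frac12(x\,dy-y\,dx)$ and Lebesgue measure $dq$. Let $$B=b_1\,dx\wedge\omega+b_2\,dy\wedge\omega,\qquad b_1,b_2\in C^\infty(\mathbb R^3;\mathbb R),$$ be a horizontal magnetic field, that is, $dB=0$, and assume that $b_1$ and $b_2$ are supported in the cylinder $\{x^2+y^2\le r_0^2\}$ for some $r_0>0$. Let $b_r=b_1\cos\varphi+b_2\sin\varphi$ be the coefficient of $dr\wedge\omega$ when $B$ is written as $b_r\,dr\wedge\omega+b_\varphi\,r\,d\varphi\wedge\omega$ in cylindrical coordinates, and define the primitive of $B$ by $$\mathfrak b(r\cos\varphi,r\sin\varphi,z)=-\int_r^{+\infty}b_r(t\cos\varphi,t\sin\varphi,z)\,dt,\qquad r>0 .$$ Then for every $z\in\mathbb R$ the function $\mathfrak b(\cdot,\cdot,z)$ is integrable on $\mathbb R^2$, and the flux $$\mathfrak F_B=\frac1{2\pi}\int_{\mathbb R^2}\mathfrak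 b(x,y,z)\,dx\,dy$$ does not depend on $z$. Moreover, if $\mathfrak F_B\notin\mathbb Z$, then there is a constant $c(B)>0$, depending only on $B$, such that for every vector potential $A$ of $B$ $$-\Delta_A\ \ge\ \frac{c(B)}{1+r^2}\qquad\text{in }L^2(\mathbb H^1)$$ in the sense of quadratic forms. Here a vector potential of $B$ is a smooth real horizontal one-form $A=A_x\,dx+A_y\,dy\bmod\omega$ for which there is a smooth $A_\omega$ with $d(A_x\,dx+A_y\,dy+A_\omega\,\omega)=B$; the operator $-\Delta_A$ is the self-adjoint operator in $L^2(\mathbb H^1)$ associated with the closure of the form $$Q_A(u)=\int_{\mathbb H^1}\big(|Xu+iA_xu|^2+|Yu+iA_yu|^2\big)\,dq,\qquad u\in C_c^\infty(\mathbb H^1;\mathbb C);$$ and the inequality means that $\int_{\mathbb H^1}\frac{c(B)}{1+r^2}|u|^2\,dq$ is at most the value at $u$ of the closure of $Q_A$, for every $u$ in its domain. -/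

import Mathlib

open MeasureTheory Filter Topology
open scoped ContDiff

noncomputable section

/-- The underlying manifold `ℝ³` of the Heisenberg group `ℍ¹`; a point is `q = (x, y, z)`.
The measure `volume` on it is Lebesgue measure `dx dy dz`. -/
abbrev Heisenberg : Type := ℝ × ℝ × ℝ

namespace Heisenberg

/-- The distance `r = √(x² + y²)` to the `z`-axis. -/
def radius (q : Heisenberg) : ℝ := Real.sqrt (q.1 ^ 2 + q.2.1 ^ 2)

/-- The closed solid cylinder `{x² + y² ≤ r₀²}`. -/
def cylinder (r₀ : ℝ) : Set Heisenberg := {q | q.1 ^ 2 + q.2.1 ^ 2 ≤ r₀ ^ 2}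

/-- The left-invariant vector field `X = ∂ₓ - (y/2) ∂_z`. -/
def fieldX (q : Heisenberg) : Heisenberg := (1, 0, -(q.2.1 / 2))

/-- The left-invariant vector field `Y = ∂_y + (x/2) ∂_z`. -/
def fieldY (q : Heisenberg) : Heisenberg := (0, 1, q.1 / 2)

/-- The covector `dx`. -/
def dx : Heisenberg →L[ℝ] ℝ := ContinuousLinearMap.fst ℝ ℝ (ℝ × ℝ)

/-- The covector `dy`. -/
def dy : Heisenberg →L[ℝ] ℝ :=
  (ContinuousLinearMap.fst ℝ ℝ ℝ).comp (ContinuousLinearMap.snd ℝ ℝ (ℝ × ℝ))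

/-- The covector `dz`. -/
def dz : Heisenberg →L[ℝ] ℝ :=
  (ContinuousLinearMap.snd ℝ ℝ ℝ).comp (ContinuousLinearMap.snd ℝ ℝ (ℝ × ℝ))

/-- The contact form `ω = dz - (x dy - y dx)/2`, whose kernel is spanned by `X` and `Y`. -/
def contactForm (q : Heisenberg) : Heisenberg →L[ℝ] ℝ :=
  dz - (1 / 2 : ℝ) • (q.1 • dy - q.2.1 • dx)

/-- The wedge product of two covectors,
`(α ∧ β)(v₀, v₁) = α(v₀) β(v₁) - α(v₁) β(v₀)` (see `wedge_apply`). -/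
def wedge (α β : Heisenberg →L[ℝ] ℝ) : Heisenberg [⋀^Fin 2]→L[ℝ] ℝ :=
  ContinuousMultilinearMap.alternatization
    ((ContinuousMultilinearMap.mkPiAlgebra ℝ (Fin 2) ℝ).compContinuousLinearMap ![α, β])

theorem wedge_apply (α β : Heisenberg →L[ℝ] ℝ) (v : Fin 2 → Heisenberg) :
    wedge α β v = α (v 0) * β (v 1) - α (v 1) * β (v 0) := by
  simp only [wedge, ContinuousMultilinearMap.alternatization_apply_apply]
  rw [show (Finset.univ : Finset (Equiv.Perm (Fin 2))) = {1, Equiv.swap 0 1} from by decide,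
    Finset.sum_pair (by decide)]
  simp [Fin.prod_univ_two]
  ring

/-- The differential `1`-form `a₁ dx + a₂ dy + a₃ ω`. -/
def oneForm (a₁ a₂ a₃ : Heisenberg → ℝ) (q : Heisenberg) : Heisenberg [⋀^Fin 1]→L[ℝ] ℝ :=
  ContinuousAlternatingMap.ofSubsingleton ℝ Heisenberg ℝ (0 : Fin 1)
    (a₁ q • dx + a₂ q • dy + a₃ q • contactForm q)

/-- The horizontal differential `2`-form `b₁ dx ∧ ω + b₂ dy ∧ ω`. -/
def horizontalTwoForm (b₁ b₂ : Heisenberg → ℝ) (q : Heisenberg) :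
    Heisenberg [⋀^Fin 2]→L[ℝ] ℝ :=
  b₁ q • wedge dx (contactForm q) + b₂ q • wedge dy (contactForm q)

/-- A horizontal magnetic field on `ℍ¹`: a smooth closed `2`-form `b₁ dx ∧ ω + b₂ dy ∧ ω`. -/
structure MagneticField where
  b₁ : Heisenberg → ℝ
  b₂ : Heisenberg → ℝ
  smooth₁ : ContDiff ℝ ∞ b₁
  smooth₂ : ContDiff ℝ ∞ b₂
  closed : ∀ q, extDeriv (horizontalTwoForm b₁ b₂) q = 0

namespace MagneticField

/-- The `2`-form `B = b₁ dx ∧ ω + b₂ dy ∧ ω`. -/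
def form (B : MagneticField) : Heisenberg → Heisenberg [⋀^Fin 2]→L[ℝ] ℝ :=
  horizontalTwoForm B.b₁ B.b₂

/-- `B` is supported in `{r ≤ r₀}`, that is, its coefficients are. -/
def SupportedInCylinder (B : MagneticField) (r₀ : ℝ) : Prop :=
  tsupport B.b₁ ⊆ cylinder r₀ ∧ tsupport B.b₂ ⊆ cylinder r₀

/-- The primitive of `B`. At a point `(r cos φ, r sin φ, z)` with `r > 0` it is
`- ∫_r^∞ b_r(t cos φ, t sin φ, z) dt`, where `b_r = b₁ cos φ + b₂ sin φ` is the coefficient of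
`dr ∧ ω` when `B` is written in the coframe `dr, r dφ, ω`; here `cos φ = x / r` and
`sin φ = y / r`. On the null set `r = 0`, where `φ` is undefined, the value is `0`. -/
def primitive (B : MagneticField) (q : Heisenberg) : ℝ :=
  -∫ t in Set.Ioi (radius q),
    (q.1 / radius q * B.b₁ (t * (q.1 / radius q), t * (q.2.1 / radius q), q.2.2) +
      q.2.1 / radius q * B.b₂ (t * (q.1 / radius q), t * (q.2.1 / radius q), q.2.2))

/-- The integral over the plane at height `z` of the primitive of `B`, divided by `2π`. -/
def flux (B : MagneticField) (z : ℝ) : ℝ :=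
  1 / (2 * Real.pi) * ∫ ξ : ℝ × ℝ, B.primitive (ξ.1, ξ.2, z)

end MagneticField

/-- A smooth horizontal `1`-form `A = A_x dx + A_y dy mod ω` on `ℍ¹`. -/
structure HorizontalOneForm where
  Ax : Heisenberg → ℝ
  Ay : Heisenberg → ℝ
  smoothX : ContDiff ℝ ∞ Ax
  smoothY : ContDiff ℝ ∞ Ay

namespace HorizontalOneForm

/-- `A` is a vector potential of `B`: `D A = B` for the Rumin differential `D`, that is, `A` has a
smooth representative `A_x dx + A_y dy + A_ω ω` modulo `ω` whose exterior derivative is the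
horizontal form `B`. (The coefficient `A_ω` is then unique.) -/
def IsVectorPotential (A : HorizontalOneForm) (B : MagneticField) : Prop :=
  ∃ Aω : Heisenberg → ℝ, ContDiff ℝ ∞ Aω ∧
    ∀ q, extDeriv (oneForm A.Ax A.Ay Aω) q = B.form q

/-- The component `(X + i A_x) u` of `(d_H + i A) u`. -/
def covX (A : HorizontalOneForm) (u : Heisenberg → ℂ) (q : Heisenberg) : ℂ :=
  fderiv ℝ u q (fieldX q) + Complex.I * (A.Ax q : ℂ) * u q

/-- The component `(Y + i A_y) u` of `(d_H + i A) u`. -/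
def covY (A : HorizontalOneForm) (u : Heisenberg → ℂ) (q : Heisenberg) : ℂ :=
  fderiv ℝ u q (fieldY q) + Complex.I * (A.Ay q : ℂ) * u q

/-- The quadratic form `Q_A(u) = ∫ |(d_H + i A) u|² dq`, used for `u ∈ C_c^∞(ℍ¹)`. -/
def energy (A : HorizontalOneForm) (u : Heisenberg → ℂ) : ℝ :=
  ∫ q, (‖A.covX u q‖ ^ 2 + ‖A.covY u q‖ ^ 2)

end HorizontalOneForm

/-- The space `C_c^∞(ℍ¹)` of complex-valued test functions. -/
def IsTestFunction (u : Heisenberg → ℂ) : Prop :=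
  ContDiff ℝ ∞ u ∧ HasCompactSupport u

namespace HorizontalOneForm

/-- The closure of the form `Q_A`, with initial domain `C_c^∞(ℍ¹)`, in `L²(ℍ¹)`: the function `u`
belongs to the domain of the closure, with value `E`, if there are test functions `φ n → u` in
`L²(ℍ¹)` that are Cauchy for `Q_A` and have `Q_A(φ n) → E`. -/
def HasClosedEnergy (A : HorizontalOneForm) (u : Heisenberg → ℂ) (E : ℝ) : Prop :=
  MemLp u 2 volume ∧
    ∃ φ : ℕ → Heisenberg → ℂ,
      (∀ n, IsTestFunction (φ n)) ∧
      Tendsto (fun n => eLpNorm (φ n - u) 2 volume) atTop (𝓝 0) ∧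
      (∀ ε : ℝ, 0 < ε → ∃ N : ℕ, ∀ m, N ≤ m → ∀ n, N ≤ n → A.energy (φ m - φ n) < ε) ∧
      Tendsto (fun n => A.energy (φ n)) atTop (𝓝 E)

/-- The operator inequality `-Δ_A ≥ w` in `L²(ℍ¹)`, in the sense of quadratic forms: `-Δ_A` is the
operator associated with the closure of `Q_A`, and every `u` in the form domain of `-Δ_A` is in
the form domain of `w`, with `∫ w |u|² ≤ Q_A(u)`. -/
def LaplacianGE (A : HorizontalOneForm) (w : Heisenberg → ℝ) : Prop :=
  ∀ (u : Heisenberg → ℂ) (E : ℝ), A.HasClosedEnergy u E →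
    Integrable (fun q => w q * ‖u q‖ ^ 2) ∧ ∫ q, w q * ‖u q‖ ^ 2 ≤ E

end HorizontalOneForm

end Heisenberg

end

/-! Flux. Put `m = x b₁ + y b₂` (`radialMoment`). Substituting `t = r s` writes the primitive as
`-∫_1^∞ m(sξ, z) ds / s`. Fubini and scaling in the plane then give integrability and `2π F = -½ ∫
m(ξ, z) dξ`. Closedness of `B` reads `∂_x b₂ - ∂_y b₁ = ½ ∂_z m`, so the `z`-derivative of `∫ m` is
the integral of a curl with compact support in the plane and vanishes.

Holonomy. Outside the cylinder a representative `A_x dx + A_y dy + A_ω ω` is closed, and by Green's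
theorem its circulation around the cylinder is `2π F`. A planar loop lifts to a closed horizontal
curve only if its signed area is zero, so a simple loop around the cylinder is not available. A
figure eight is: one lobe surrounds the cylinder, the other compensates the area without surrounding
it, and the holonomy is `e^{2πiF}` (`phase_figureEight`).

Hardy inequality. Parallel transport along a path changes `u` by at most the integral of `|(d_H +
iA) u|` along it. Around the figure eight the change is exactly `(e^{2πiF} - 1) u`, which controls
`|u|` when `F` is not an integer. The starting point is now averaged over a box of scale `l`;
horizontal translations preserve Lebesgue measure, so the box satisfies `∫ |u|² ≤ C l² ∫ |(d_H + iA)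
u|²` with energy taken over a shell of scale `l` (`lintegral_basePrism_le`). One or two further
segments carry the estimate to a dyadic annulus and to the inner cylinder (`lintegral_annulus_le`,
`lintegral_cylinder_le`). The annuli are summed with weights `l⁻²`; the shells have bounded overlap
(`lintegral_hardy_le`). All constants depend only on `r₀` and `F`, never on `A`. Finally the
inequality passes to the form closure because the weight is bounded. -/

noncomputable section

namespace Heisenberg

/-! ### Exterior calculus in coordinates. -/

@[simp] theorem dx_apply (v : Heisenberg) : dx v = v.1 := rfl

@[simp] theorem dy_apply (v : Heisenberg) : dy v = v.2.1 := rfl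

@[simp] theorem dz_apply (v : Heisenberg) : dz v = v.2.2 := rfl

@[simp] theorem contactForm_apply (q v : Heisenberg) :
    contactForm q v = v.2.2 - 1 / 2 * (q.1 * v.2.1 - q.2.1 * v.1) := by
  simp [contactForm]

theorem contDiff_contactForm : ContDiff ℝ ∞ contactForm := by
  unfold contactForm
  fun_prop

/-- Isolates the dependence on `q` in scalar coefficients of constant forms, which makes regularity
in `q` evident. -/
theorem wedge_contactForm (β : Heisenberg →L[ℝ] ℝ) (q : Heisenberg) :
    wedge β (contactForm q) =
      wedge β dz - (q.1 / 2) • wedge β dy + (q.2.1 / 2) • wedge β dx := by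
  ext v
  simp only [ContinuousAlternatingMap.add_apply, ContinuousAlternatingMap.sub_apply,
    ContinuousAlternatingMap.smul_apply, wedge_apply, contactForm_apply, dx_apply, dy_apply,
    dz_apply, smul_eq_mul]
  ring

theorem differentiable_horizontalTwoForm {b₁ b₂ : Heisenberg → ℝ} (h₁ : Differentiable ℝ b₁)
    (h₂ : Differentiable ℝ b₂) : Differentiable ℝ (horizontalTwoForm b₁ b₂) := by
  unfold horizontalTwoForm
  simp only [wedge_contactForm]
  fun_prop

theorem horizontalTwoForm_apply (b₁ b₂ : Heisenberg → ℝ) (q : Heisenberg)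
    (v : Fin 2 → Heisenberg) :
    horizontalTwoForm b₁ b₂ q v =
      b₁ q * ((v 0).1 * contactForm q (v 1) - (v 1).1 * contactForm q (v 0)) +
      b₂ q * ((v 0).2.1 * contactForm q (v 1) - (v 1).2.1 * contactForm q (v 0)) := by
  simp only [horizontalTwoForm, ContinuousAlternatingMap.add_apply,
    ContinuousAlternatingMap.smul_apply, wedge_apply, dx_apply, dy_apply, smul_eq_mul]

/-- The covector field underlying `oneForm`. -/
def covector (a₁ a₂ a₃ : Heisenberg → ℝ) (q : Heisenberg) : Heisenberg →L[ℝ] ℝ :=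
  a₁ q • dx + a₂ q • dy + a₃ q • contactForm q

theorem contDiff_covector {a₁ a₂ a₃ : Heisenberg → ℝ} (h₁ : ContDiff ℝ ∞ a₁)
    (h₂ : ContDiff ℝ ∞ a₂) (h₃ : ContDiff ℝ ∞ a₃) : ContDiff ℝ ∞ (covector a₁ a₂ a₃) := by
  have := contDiff_contactForm
  unfold covector
  fun_prop

theorem extDeriv_oneForm_apply {a₁ a₂ a₃ : Heisenberg → ℝ} (h₁ : ContDiff ℝ ∞ a₁)
    (h₂ : ContDiff ℝ ∞ a₂) (h₃ : ContDiff ℝ ∞ a₃) (q v w : Heisenberg) :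
    extDeriv (oneForm a₁ a₂ a₃) q ![v, w] =
      fderiv ℝ (covector a₁ a₂ a₃) q v w - fderiv ℝ (covector a₁ a₂ a₃) q w v := by
  have hd : Differentiable ℝ (covector a₁ a₂ a₃) :=
    (contDiff_covector h₁ h₂ h₃).differentiable (by simp)
  have hD : DifferentiableAt ℝ (oneForm a₁ a₂ a₃) q :=
    ((ContinuousAlternatingMap.ofSubsingletonLIE (𝕜 := ℝ) (E := Heisenberg) (F := ℝ)
      (ι := Fin 1) 0).differentiable.comp hd) q
  have key : ∀ v w : Heisenberg,
      fderiv ℝ (fun p => covector a₁ a₂ a₃ p v) q w = fderiv ℝ (covector a₁ a₂ a₃) q w v := by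
    intro v w
    rw [fderiv_clm_apply (hd q) (differentiableAt_const v)]
    simp
  rw [extDeriv_apply hD, Fin.sum_univ_two, ← key, ← key]
  have e0 : ∀ p, oneForm a₁ a₂ a₃ p ((0 : Fin 2).removeNth ![v, w]) = covector a₁ a₂ a₃ p w := by
    intro p; rfl
  have e1 : ∀ p, oneForm a₁ a₂ a₃ p ((1 : Fin 2).removeNth ![v, w]) = covector a₁ a₂ a₃ p v := by
    intro p; rfl
  simp only [e0, e1]
  simp [sub_eq_add_neg]

/-- Closedness of a horizontal magnetic field, in coordinates. -/
theorem MagneticField.closed_coord (B : MagneticField) (q : Heisenberg) :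
    fderiv ℝ B.b₂ q (1, 0, 0) - fderiv ℝ B.b₁ q (0, 1, 0) =
      fderiv ℝ (fun p : Heisenberg => (p.1 * B.b₁ p + p.2.1 * B.b₂ p) / 2) q (0, 0, 1) := by
  have hd := differentiable_horizontalTwoForm (B.smooth₁.differentiable (by simp))
    (B.smooth₂.differentiable (by simp))
  have h := extDeriv_apply (hd q) ![((1, 0, 0) : Heisenberg), (0, 1, 0), (0, 0, 1)]
  rw [B.closed q, Fin.sum_univ_three] at h
  -- The three faces of `(∂_x, ∂_y, ∂_z)`. The last one is nonzero because `ω(∂_x) = y/2` and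
  -- `ω(∂_y) = -x/2`.
  have e0 : ∀ p, horizontalTwoForm B.b₁ B.b₂ p
      ((0 : Fin 3).removeNth ![((1, 0, 0) : Heisenberg), (0, 1, 0), (0, 0, 1)]) = B.b₂ p := by
    intro p; rw [horizontalTwoForm_apply]; simp [Fin.removeNth]
  have e1 : ∀ p, horizontalTwoForm B.b₁ B.b₂ p
      ((1 : Fin 3).removeNth ![((1, 0, 0) : Heisenberg), (0, 1, 0), (0, 0, 1)]) = B.b₁ p := by
    intro p; rw [horizontalTwoForm_apply]; simp [Fin.removeNth, Fin.succAbove]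
  have e2 : ∀ p, horizontalTwoForm B.b₁ B.b₂ p
      ((2 : Fin 3).removeNth ![((1, 0, 0) : Heisenberg), (0, 1, 0), (0, 0, 1)]) =
        -((p.1 * B.b₁ p + p.2.1 * B.b₂ p) / 2) := by
    intro p; rw [horizontalTwoForm_apply]; simp [Fin.removeNth, Fin.succAbove]; ring
  simp only [e0, e1, e2, fderiv_fun_neg] at h
  simp at h
  linarith

/-! ### Integrals over the plane: dilation averages and Green's theorem. -/

section PlaneIntegrals

/-- Scaling in the plane contributes `s⁻²`, so the integral over `ξ` of the absolute value is a
multiple of `s⁻³`, integrable on `(1, ∞)`. -/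
theorem integrable_dilation_average {g : ℝ × ℝ → ℝ} (hg : Continuous g)
    (hs : HasCompactSupport g) :
    Integrable (fun p : (ℝ × ℝ) × ℝ => g (p.2 • p.1) / p.2)
      (volume.prod (volume.restrict (Set.Ioi (1 : ℝ)))) := by
  have hgi : Integrable g := hg.integrable_of_hasCompactSupport hs
  have hm : Measurable (fun p : (ℝ × ℝ) × ℝ => g (p.2 • p.1) / p.2) :=
    ((hg.comp (by fun_prop)).measurable).div measurable_snd
  rw [integrable_prod_iff' hm.aestronglyMeasurable]
  refine ⟨?_, ?_⟩
  · filter_upwards [ae_restrict_mem measurableSet_Ioi] with s hs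
    have hs0 : s ≠ 0 := (lt_trans one_pos hs).ne'
    exact (hgi.comp_smul hs0).div_const s
  · have h3 : IntegrableOn (fun s : ℝ => s ^ (-3 : ℝ) * ∫ ξ, ‖g ξ‖) (Set.Ioi 1) :=
      (integrableOn_Ioi_rpow_of_lt (by norm_num) one_pos).mul_const _
    refine h3.congr_fun (fun s hs => ?_) measurableSet_Ioi
    have hs0 : (0 : ℝ) < s := lt_trans one_pos hs
    simp only [norm_div]
    rw [integral_div, Measure.integral_comp_smul volume (fun ξ => ‖g ξ‖) s]
    simp only [Module.finrank_prod, Module.finrank_self, smul_eq_mul]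
    rw [Real.rpow_neg hs0.le, show (3 : ℝ) = (3 : ℕ) by norm_num, Real.rpow_natCast,
      abs_of_pos (by positivity), Real.norm_of_nonneg hs0.le]
    field_simp
    ring

theorem integral_dilation_average {g : ℝ × ℝ → ℝ} (hg : Continuous g)
    (hs : HasCompactSupport g) :
    ∫ ξ, ∫ s in Set.Ioi (1 : ℝ), g (s • ξ) / s = 1 / 2 * ∫ ξ, g ξ := by
  rw [integral_integral_swap (integrable_dilation_average hg hs)]
  have : ∀ s ∈ Set.Ioi (1 : ℝ), ∫ ξ, g (s • ξ) / s = s ^ (-3 : ℝ) * ∫ ξ, g ξ := by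
    intro s hs
    have hs0 : (0 : ℝ) < s := lt_trans one_pos hs
    rw [integral_div, Measure.integral_comp_smul volume g s]
    simp only [Module.finrank_prod, Module.finrank_self, smul_eq_mul]
    rw [Real.rpow_neg hs0.le, show (3 : ℝ) = (3 : ℕ) by norm_num, Real.rpow_natCast,
      abs_of_pos (by positivity)]
    field_simp
    ring
  rw [setIntegral_congr_fun measurableSet_Ioi this, integral_mul_const,
    integral_Ioi_rpow_of_lt (by norm_num) one_pos]
  norm_num

/-- The square `[-a, a]²` contains the support of a function that vanishes off a disc of radius
less than `a`. -/
theorem integral_plane_eq_intervalIntegral {g : ℝ × ℝ → ℝ} (hg : Continuous g) {r a : ℝ}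
    (hr : 0 ≤ r) (ha : r < a) (h0 : ∀ ξ : ℝ × ℝ, r ^ 2 < ξ.1 ^ 2 + ξ.2 ^ 2 → g ξ = 0) :
    ∫ ξ, g ξ = ∫ x in (-a)..a, ∫ y in (-a)..a, g (x, y) := by
  have haa : -a ≤ a := by linarith
  rw [← setIntegral_eq_integral_of_forall_compl_eq_zero (s := Set.Ioc (-a) a ×ˢ Set.Ioc (-a) a)]
  · rw [Measure.volume_eq_prod, setIntegral_prod]
    · simp only [intervalIntegral.integral_of_le haa]
    · exact (hg.continuousOn.integrableOn_compact (isCompact_Icc.prod isCompact_Icc)).mono_set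
        (Set.prod_mono Set.Ioc_subset_Icc_self Set.Ioc_subset_Icc_self)
  · intro ξ hξ
    apply h0
    by_contra hle
    push Not at hle
    apply hξ
    have h1 : |ξ.1| < a := abs_lt_of_sq_lt_sq (by nlinarith [sq_nonneg ξ.2]) (by linarith)
    have h2 : |ξ.2| < a := abs_lt_of_sq_lt_sq (by nlinarith [sq_nonneg ξ.1]) (by linarith)
    rw [abs_lt] at h1 h2
    exact ⟨⟨h1.1, h1.2.le⟩, ⟨h2.1, h2.2.le⟩⟩

theorem hasCompactSupport_of_eq_zero {g : ℝ × ℝ → ℝ} {r : ℝ} (hr : 0 ≤ r)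
    (h0 : ∀ ξ : ℝ × ℝ, r ^ 2 < ξ.1 ^ 2 + ξ.2 ^ 2 → g ξ = 0) : HasCompactSupport g := by
  apply HasCompactSupport.intro (K := Set.Icc (-r) r ×ˢ Set.Icc (-r) r)
    (isCompact_Icc.prod isCompact_Icc)
  intro ξ hξ
  apply h0
  by_contra hle
  push Not at hle
  apply hξ
  have h1 : |ξ.1| ≤ r := abs_le_of_sq_le_sq (by nlinarith [sq_nonneg ξ.2]) hr
  have h2 : |ξ.2| ≤ r := abs_le_of_sq_le_sq (by nlinarith [sq_nonneg ξ.1]) hr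
  rw [abs_le] at h1 h2
  exact ⟨h1, h2⟩

/-- Green's theorem on the square `[-a, a]²`. -/
theorem integral_square_curl {F G : ℝ × ℝ → ℝ} (hF : ContDiff ℝ 1 F) (hG : ContDiff ℝ 1 G)
    (a : ℝ) :
    ∫ x in (-a)..a, ∫ y in (-a)..a, (fderiv ℝ G (x, y) (1, 0) - fderiv ℝ F (x, y) (0, 1)) =
      (((∫ x in (-a)..a, F (x, -a)) - ∫ x in (-a)..a, F (x, a)) +
        ∫ y in (-a)..a, G (a, y)) - ∫ y in (-a)..a, G (-a, y) := by
  have hF' : Continuous (fun p => fderiv ℝ F p (0, 1)) :=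
    (hF.continuous_fderiv (by simp)).clm_apply continuous_const
  have hG' : Continuous (fun p => fderiv ℝ G p (1, 0)) :=
    (hG.continuous_fderiv (by simp)).clm_apply continuous_const
  have h := integral2_divergence_prod_of_hasFDerivAt G (fun p => -F p) (fderiv ℝ G)
    (fun p => -fderiv ℝ F p) (-a) (-a) a a hG.continuous.continuousOn
    hF.continuous.neg.continuousOn
    (fun x _ => (hG.differentiable (by simp) x).hasFDerivAt)
    (fun x _ => (hF.differentiable (by simp) x).hasFDerivAt.neg) ?_
  · simp only [neg_apply, ← sub_eq_add_neg,
      intervalIntegral.integral_neg] at h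
    rw [h]
    ring
  · apply ContinuousOn.integrableOn_compact
    · exact isCompact_uIcc.prod isCompact_uIcc
    · exact (hG'.add hF'.neg).continuousOn

end PlaneIntegrals

/-! ### The flux and its independence of the height. -/

namespace MagneticField

variable {B : MagneticField} {r₀ : ℝ}

/-- The function `x b₁ + y b₂`. -/
def radialMoment (B : MagneticField) (q : Heisenberg) : ℝ := q.1 * B.b₁ q + q.2.1 * B.b₂ q

theorem contDiff_radialMoment (B : MagneticField) : ContDiff ℝ ∞ B.radialMoment := by
  have := B.smooth₁
  have := B.smooth₂
  unfold radialMoment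
  fun_prop

theorem SupportedInCylinder.eventually_eq_zero₁ (hB : B.SupportedInCylinder r₀) {q : Heisenberg}
    (hq : r₀ ^ 2 < q.1 ^ 2 + q.2.1 ^ 2) : B.b₁ =ᶠ[𝓝 q] 0 := by
  rw [← notMem_tsupport_iff_eventuallyEq]
  exact fun h => absurd (hB.1 h) (not_le.2 hq)

theorem SupportedInCylinder.eventually_eq_zero₂ (hB : B.SupportedInCylinder r₀) {q : Heisenberg}
    (hq : r₀ ^ 2 < q.1 ^ 2 + q.2.1 ^ 2) : B.b₂ =ᶠ[𝓝 q] 0 := by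
  rw [← notMem_tsupport_iff_eventuallyEq]
  exact fun h => absurd (hB.2 h) (not_le.2 hq)

theorem SupportedInCylinder.radialMoment_eq_zero (hB : B.SupportedInCylinder r₀) {q : Heisenberg}
    (hq : r₀ ^ 2 < q.1 ^ 2 + q.2.1 ^ 2) : B.radialMoment q = 0 := by
  simp [radialMoment, (hB.eventually_eq_zero₁ hq).self_of_nhds,
    (hB.eventually_eq_zero₂ hq).self_of_nhds]

/-- The substitution `t = r s` removes the polar coordinates and the singular direction `ξ / r`. -/
theorem primitive_eq (B : MagneticField) (ξ : ℝ × ℝ) (z : ℝ) :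
    B.primitive (ξ.1, ξ.2, z) =
      -∫ s in Set.Ioi (1 : ℝ), B.radialMoment ((s • ξ).1, (s • ξ).2, z) / s := by
  obtain ⟨x, y⟩ := ξ
  unfold primitive
  set r := radius (x, y, z) with hr
  congr 1
  have hr0 : 0 ≤ r := Real.sqrt_nonneg _
  -- On the axis both sides vanish: `x / 0 = 0` on the left, and `radialMoment` is zero at the
  -- origin of the plane on the right.
  rcases hr0.eq_or_lt with h | h
  · have h0 : x ^ 2 + y ^ 2 ≤ 0 := Real.sqrt_eq_zero'.1 h.symm
    have hx : x = 0 := by nlinarith [sq_nonneg x, sq_nonneg y]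
    have hy : y = 0 := by nlinarith [sq_nonneg x, sq_nonneg y]
    simp [radialMoment, hx, hy]
  · have := integral_comp_mul_left_Ioi' (fun t => x / r * B.b₁ (t * (x / r), t * (y / r), z) +
      y / r * B.b₂ (t * (x / r), t * (y / r), z)) 1 h
    rw [mul_one] at this
    simp only
    rw [← this, ← integral_smul]
    refine setIntegral_congr_fun measurableSet_Ioi fun s hs => ?_
    have hs0 : s ≠ 0 := (lt_trans one_pos hs).ne'
    have hr0 := h.ne'
    simp only [radialMoment, smul_eq_mul, Prod.smul_mk]
    rw [show r * s * (x / r) = s * x by field_simp, show r * s * (y / r) = s * y by field_simp]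
    field_simp

theorem SupportedInCylinder.integrable_primitive (hB : B.SupportedInCylinder r₀) (hr₀ : 0 ≤ r₀)
    (z : ℝ) : Integrable (fun ξ : ℝ × ℝ => B.primitive (ξ.1, ξ.2, z)) := by
  have hc : Continuous (fun ξ : ℝ × ℝ => B.radialMoment (ξ.1, ξ.2, z)) :=
    B.contDiff_radialMoment.continuous.comp (by fun_prop)
  have h := (integrable_dilation_average hc
    (hasCompactSupport_of_eq_zero hr₀ fun ξ hξ => hB.radialMoment_eq_zero hξ)).integral_prod_left
  simp only [primitive_eq]
  exact h.neg

theorem SupportedInCylinder.flux_eq (hB : B.SupportedInCylinder r₀) (hr₀ : 0 ≤ r₀) (z : ℝ) :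
    2 * Real.pi * B.flux z = -(1 / 2 * ∫ ξ : ℝ × ℝ, B.radialMoment (ξ.1, ξ.2, z)) := by
  have hc : Continuous (fun ξ : ℝ × ℝ => B.radialMoment (ξ.1, ξ.2, z)) :=
    B.contDiff_radialMoment.continuous.comp (by fun_prop)
  have h := integral_dilation_average hc
    (hasCompactSupport_of_eq_zero hr₀ fun ξ hξ => hB.radialMoment_eq_zero hξ)
  unfold flux
  simp only [primitive_eq]
  rw [integral_neg, h]
  field_simp

/-- By closedness the `z`-derivative of `radialMoment` is twice a planar curl, whose integral is
zero by Green's theorem on a square with boundary off the cylinder. -/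
theorem SupportedInCylinder.integral_radialMoment_eq (hB : B.SupportedInCylinder r₀)
    (hr₀ : 0 ≤ r₀) (z₁ z₂ : ℝ) :
    ∫ ξ : ℝ × ℝ, B.radialMoment (ξ.1, ξ.2, z₁) = ∫ ξ : ℝ × ℝ, B.radialMoment (ξ.1, ξ.2, z₂) := by
  have hc : ∀ z, Continuous (fun ξ : ℝ × ℝ => B.radialMoment (ξ.1, ξ.2, z)) := fun z =>
    B.contDiff_radialMoment.continuous.comp (by fun_prop)
  have hi : ∀ z, Integrable (fun ξ : ℝ × ℝ => B.radialMoment (ξ.1, ξ.2, z)) := fun z =>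
    (hc z).integrable_of_hasCompactSupport
      (hasCompactSupport_of_eq_zero hr₀ fun ξ hξ => hB.radialMoment_eq_zero hξ)
  set D : Heisenberg → ℝ := fun q => fderiv ℝ B.radialMoment q (0, 0, 1) with hD
  have hDc : Continuous D :=
    (B.contDiff_radialMoment.continuous_fderiv (by simp)).clm_apply continuous_const
  have hDz : ∀ (ξ : ℝ × ℝ) (z : ℝ), r₀ ^ 2 < ξ.1 ^ 2 + ξ.2 ^ 2 → D (ξ.1, ξ.2, z) = 0 := by
    intro ξ z hξ
    have : B.radialMoment =ᶠ[𝓝 ((ξ.1, ξ.2, z) : Heisenberg)] 0 := by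
      filter_upwards [hB.eventually_eq_zero₁ (q := (ξ.1, ξ.2, z)) hξ,
        hB.eventually_eq_zero₂ (q := (ξ.1, ξ.2, z)) hξ] with q h1 h2
      simp [radialMoment, h1, h2]
    simp [hD, this.fderiv_eq]
  have hDcurl : ∀ q, D q = 2 * (fderiv ℝ B.b₂ q (1, 0, 0) - fderiv ℝ B.b₁ q (0, 1, 0)) := by
    intro q
    rw [B.closed_coord q]
    have : (fun p : Heisenberg => (p.1 * B.b₁ p + p.2.1 * B.b₂ p) / 2) =
        fun p => (1 / 2 : ℝ) • B.radialMoment p := by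
      funext p
      simp [radialMoment]
      ring
    rw [this, fderiv_fun_const_smul (B.contDiff_radialMoment.differentiable (by simp) q)]
    simp [hD]
  have hzero : ∀ z, ∫ ξ : ℝ × ℝ, D (ξ.1, ξ.2, z) = 0 := by
    intro z
    rw [integral_plane_eq_intervalIntegral (g := fun ξ => D (ξ.1, ξ.2, z))
      (hDc.comp (by fun_prop)) hr₀ (lt_add_one r₀)
      (fun ξ hξ => hDz ξ z hξ)]
    have hF : ContDiff ℝ 1 (fun ξ : ℝ × ℝ => B.b₁ (ξ.1, ξ.2, z)) :=
      (B.smooth₁.of_le (by simp)).comp (by fun_prop)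
    have hG : ContDiff ℝ 1 (fun ξ : ℝ × ℝ => B.b₂ (ξ.1, ξ.2, z)) :=
      (B.smooth₂.of_le (by simp)).comp (by fun_prop)
    have hsl : ∀ (x y : ℝ) (b : Heisenberg → ℝ), ContDiff ℝ ∞ b → ∀ v : ℝ × ℝ,
        fderiv ℝ (fun ξ : ℝ × ℝ => b (ξ.1, ξ.2, z)) (x, y) v =
          fderiv ℝ b (x, y, z) (v.1, v.2, 0) := by
      intro x y b hb v
      have h1 : HasFDerivAt (fun ξ : ℝ × ℝ => ((ξ.1, ξ.2, z) : Heisenberg))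
          ((ContinuousLinearMap.fst ℝ ℝ ℝ).prod ((ContinuousLinearMap.snd ℝ ℝ ℝ).prod 0))
          (x, y) :=
        hasFDerivAt_fst.prodMk (hasFDerivAt_snd.prodMk (hasFDerivAt_const z _))
      have h2 := ((hb.differentiable (by simp) (x, y, z)).hasFDerivAt.comp
        (x, y) h1).fderiv
      simp only [Function.comp_def] at h2
      rw [h2]
      rfl
    have hout : ∀ x y : ℝ, r₀ ^ 2 < x ^ 2 + y ^ 2 →
        B.b₁ (x, y, z) = 0 ∧ B.b₂ (x, y, z) = 0 := fun x y h =>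
      ⟨(hB.eventually_eq_zero₁ (q := (x, y, z)) h).self_of_nhds,
        (hB.eventually_eq_zero₂ (q := (x, y, z)) h).self_of_nhds⟩
    have h := integral_square_curl hF hG (r₀ + 1)
    have e1 : ∀ t : ℝ, r₀ ^ 2 < t ^ 2 + (r₀ + 1) ^ 2 := fun t => by nlinarith [sq_nonneg t]
    have e2 : ∀ t : ℝ, r₀ ^ 2 < t ^ 2 + (-(r₀ + 1)) ^ 2 := fun t => by nlinarith [sq_nonneg t]
    have e3 : ∀ t : ℝ, r₀ ^ 2 < (r₀ + 1) ^ 2 + t ^ 2 := fun t => by nlinarith [sq_nonneg t]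
    have e4 : ∀ t : ℝ, r₀ ^ 2 < (-(r₀ + 1)) ^ 2 + t ^ 2 := fun t => by nlinarith [sq_nonneg t]
    simp only [hsl _ _ _ B.smooth₁, hsl _ _ _ B.smooth₂, (hout _ _ (e1 _)).1,
      (hout _ _ (e2 _)).1, (hout _ _ (e3 _)).2, (hout _ _ (e4 _)).2] at h
    simp only [hDcurl, intervalIntegral.integral_const_mul, h]
    simp
  have hftc : ∀ ξ : ℝ × ℝ, ∫ z in z₁..z₂, D (ξ.1, ξ.2, z) =
      B.radialMoment (ξ.1, ξ.2, z₂) - B.radialMoment (ξ.1, ξ.2, z₁) := by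
    intro ξ
    refine intervalIntegral.integral_eq_sub_of_hasDerivAt (f := fun z =>
      B.radialMoment (ξ.1, ξ.2, z)) (fun z _ => ?_)
      ((hDc.comp (by fun_prop)).intervalIntegrable _ _)
    have h1 : HasDerivAt (fun z : ℝ => ((ξ.1, ξ.2, z) : Heisenberg)) (0, 0, 1) z :=
      (hasDerivAt_const z _).prodMk ((hasDerivAt_const z _).prodMk (hasDerivAt_id z))
    exact (B.contDiff_radialMoment.differentiable (by simp) _).hasFDerivAt.comp_hasDerivAt z h1
  have hint : Integrable (Function.uncurry fun (z : ℝ) (ξ : ℝ × ℝ) => D (ξ.1, ξ.2, z))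
      ((volume.restrict (Set.uIoc z₁ z₂)).prod volume) := by
    have hK : IsCompact (Set.uIcc z₁ z₂ ×ˢ (Set.Icc (-r₀) r₀ ×ˢ Set.Icc (-r₀) r₀)) :=
      isCompact_uIcc.prod (isCompact_Icc.prod isCompact_Icc)
    have hcont : Continuous (Function.uncurry fun (z : ℝ) (ξ : ℝ × ℝ) => D (ξ.1, ξ.2, z)) :=
      hDc.comp (by fun_prop)
    have h1 := (hcont.continuousOn (s := _)).integrableOn_compact (μ := volume.prod volume) hK
    have h2 := h1.mono_set (Set.prod_mono_left Set.uIoc_subset_uIcc)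
    rw [IntegrableOn, ← Measure.prod_restrict] at h2
    have h3 : Integrable (Function.uncurry fun (z : ℝ) (ξ : ℝ × ℝ) => D (ξ.1, ξ.2, z))
      (((volume.restrict (Set.uIoc z₁ z₂)).prod volume).restrict
        (Set.univ ×ˢ (Set.Icc (-r₀) r₀ ×ˢ Set.Icc (-r₀) r₀))) := by
      rw [← Measure.prod_restrict, Measure.restrict_univ]
      exact h2
    refine (integrableOn_iff_integrable_of_support_subset ?_).1 h3
    rintro ⟨z, ξ⟩ hne
    refine ⟨trivial, ?_⟩
    have hle : ξ.1 ^ 2 + ξ.2 ^ 2 ≤ r₀ ^ 2 := by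
      by_contra hlt
      exact hne (hDz ξ z (not_le.1 hlt))
    have h1 : |ξ.1| ≤ r₀ := abs_le_of_sq_le_sq (by nlinarith [sq_nonneg ξ.2]) hr₀
    have h2 : |ξ.2| ≤ r₀ := abs_le_of_sq_le_sq (by nlinarith [sq_nonneg ξ.1]) hr₀
    rw [abs_le] at h1 h2
    exact ⟨h1, h2⟩
  -- One order of integration gives zero by `hzero`, the other the difference of the two moments by
  -- `hftc`.
  have hsw := intervalIntegral_integral_swap hint
  simp only [hzero, hftc, intervalIntegral.integral_zero] at hsw
  rw [integral_sub (hi z₂) (hi z₁)] at hsw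
  linarith

end MagneticField

/-! ### Horizontal polygonal paths. -/

/-- The end point of the horizontal segment that starts at `q` and projects to the segment from
`(x, y)` to `(x, y) + v`. It is the right translate of `q` by `(v, 0)` in the Heisenberg group. -/
def step (v : ℝ × ℝ) (q : Heisenberg) : Heisenberg :=
  (q.1 + v.1, q.2.1 + v.2, q.2.2 + (q.1 * v.2 - q.2.1 * v.1) / 2)

/-- The velocity of the horizontal segment from `q` to `step v q`. -/
def velocity (v : ℝ × ℝ) (q : Heisenberg) : Heisenberg :=
  (v.1, v.2, (q.1 * v.2 - q.2.1 * v.1) / 2)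

/-- Since `x v₂ - y v₁` is constant in the direction `v`, horizontal segments are straight in `ℝ³`.
A convex set containing both ends therefore contains the segment. -/
theorem step_smul (t : ℝ) (v : ℝ × ℝ) (q : Heisenberg) :
    step (t • v) q = q + t • velocity v q := by
  simp only [step, velocity, Prod.smul_fst, Prod.smul_snd, smul_eq_mul]
  ext <;> simp
  ring

@[simp] theorem step_zero (q : Heisenberg) : step 0 q = q := by simp [step]

theorem hasDerivAt_step_smul (t : ℝ) (v : ℝ × ℝ) (q : Heisenberg) :
    HasDerivAt (fun s : ℝ => step (s • v) q) (velocity v q) t := by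
  simp only [step_smul]
  simpa using ((hasDerivAt_id t).smul_const (velocity v q)).const_add q

theorem contactForm_velocity (t : ℝ) (v : ℝ × ℝ) (q : Heisenberg) :
    contactForm (step (t • v) q) (velocity v q) = 0 := by
  simp only [contactForm_apply, step, velocity, Prod.smul_fst, Prod.smul_snd, smul_eq_mul]
  ring

theorem velocity_eq (t : ℝ) (v : ℝ × ℝ) (q : Heisenberg) :
    velocity v q = v.1 • fieldX (step (t • v) q) + v.2 • fieldY (step (t • v) q) := by
  simp only [velocity, fieldX, fieldY, step, Prod.smul_fst, Prod.smul_snd, smul_eq_mul]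
  ext <;> simp
  ring

/-- The end point of the horizontal path from `q` whose projection to the plane has the successive
edges `w`. -/
def endpoint : List (ℝ × ℝ) → Heisenberg → Heisenberg
  | [], q => q
  | v :: w, q => endpoint w (step v q)

namespace HorizontalOneForm

/-- The integral of `A` along the horizontal segment from `q` to `step v q`. -/
def segmentPhase (A : HorizontalOneForm) (v : ℝ × ℝ) (q : Heisenberg) : ℝ :=
  ∫ t in (0 : ℝ)..1, (v.1 * A.Ax (step (t • v) q) + v.2 * A.Ay (step (t • v) q))

/-- The integral of `A` along the horizontal path from `q` with edges `w`. -/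
def phase (A : HorizontalOneForm) : List (ℝ × ℝ) → Heisenberg → ℝ
  | [], _ => 0
  | v :: w, q => A.segmentPhase v q + A.phase w (step v q)

end HorizontalOneForm

/-! ### Local primitives of the potential and the holonomy of the figure eight. -/

section Primitives

variable {α : Heisenberg → Heisenberg →L[ℝ] ℝ} {f g : Heisenberg → ℝ} {s t : Set Heisenberg}

theorem integral_segment_of_primitive (hα : Continuous α) (hs : Convex ℝ s)
    (hf : ∀ q ∈ s, HasFDerivAt f (α q) q) {q v : Heisenberg} (hq : q ∈ s) (hv : q + v ∈ s) :
    ∫ t in (0 : ℝ)..1, α (q + t • v) v = f (q + v) - f q := by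
  have hmem : ∀ t ∈ Set.uIcc (0 : ℝ) 1, q + t • v ∈ s := by
    intro t ht
    rw [Set.uIcc_of_le zero_le_one] at ht
    exact hs.add_smul_mem hq hv ht
  have := intervalIntegral.integral_eq_sub_of_hasDerivAt (a := (0 : ℝ)) (b := 1)
    (f := fun t : ℝ => f (q + t • v)) (f' := fun t => α (q + t • v) v) ?_ ?_
  · simpa using this
  · intro t ht
    have h1 : HasDerivAt (fun t : ℝ => q + t • v) v t := by
      simpa using ((hasDerivAt_id t).smul_const v).const_add q
    exact (hf _ (hmem t ht)).comp_hasDerivAt t h1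
  · exact ((hα.comp (by fun_prop)).clm_apply continuous_const).intervalIntegrable _ _

theorem exists_sub_eq_const_of_primitives (hs : Convex ℝ s) (hso : IsOpen s) (ht : Convex ℝ t)
    (hto : IsOpen t) (hf : ∀ q ∈ s, HasFDerivAt f (α q) q)
    (hg : ∀ q ∈ t, HasFDerivAt g (α q) q) : ∃ c, ∀ q ∈ s, q ∈ t → f q - g q = c := by
  have hd : ∀ q ∈ s ∩ t, HasFDerivAt (fun p => f p - g p) (0 : Heisenberg →L[ℝ] ℝ) q := by
    intro q hq
    simpa using (hf q hq.1).fun_sub (hg q hq.2)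
  obtain ⟨c, hc⟩ := (hso.inter hto).exists_is_const_of_fderiv_eq_zero
    (hs.inter ht).isPreconnected (fun q hq => (hd q hq).differentiableAt.differentiableWithinAt)
    (fun q hq => (hd q hq).fderiv)
  exact ⟨c, fun q h1 h2 => hc q ⟨h1, h2⟩⟩

end Primitives

/-- The velocity lies in the kernel of `ω`, so the phase of a horizontal path does not see the
coefficient `a₃`. -/
theorem covector_velocity (A : HorizontalOneForm) (a₃ : Heisenberg → ℝ) (t : ℝ) (v : ℝ × ℝ)
    (q : Heisenberg) :
    covector A.Ax A.Ay a₃ (step (t • v) q) (velocity v q) =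
      v.1 * A.Ax (step (t • v) q) + v.2 * A.Ay (step (t • v) q) := by
  simp only [covector, add_apply, smul_apply, contactForm_velocity, smul_eq_mul, mul_zero]
  simp only [dx_apply, dy_apply, velocity]
  ring

theorem HorizontalOneForm.segmentPhase_eq_of_primitive {A : HorizontalOneForm}
    {a₃ f : Heisenberg → ℝ} (h₃ : ContDiff ℝ ∞ a₃) {s : Set Heisenberg} (hs : Convex ℝ s)
    (hf : ∀ q ∈ s, HasFDerivAt f (covector A.Ax A.Ay a₃ q) q) {q : Heisenberg} {v : ℝ × ℝ}
    (hq : q ∈ s) (hv : step v q ∈ s) : A.segmentPhase v q = f (step v q) - f q := by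
  have hstep : step v q = q + velocity v q := by simpa using step_smul 1 v q
  rw [hstep] at hv ⊢
  rw [← integral_segment_of_primitive (contDiff_covector A.smoothX A.smoothY h₃).continuous hs hf
    hq hv]
  unfold segmentPhase
  simp only [← step_smul, covector_velocity]

/-- The open half-space `{r₀ < β}`. -/
def halfSpace (β : Heisenberg →L[ℝ] ℝ) (r₀ : ℝ) : Set Heisenberg := {q | r₀ < β q}

theorem mem_halfSpace {β : Heisenberg →L[ℝ] ℝ} {r₀ : ℝ} {q : Heisenberg} :
    q ∈ halfSpace β r₀ ↔ r₀ < β q := Iff.rfl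

theorem convex_halfSpace (β : Heisenberg →L[ℝ] ℝ) (r₀ : ℝ) : Convex ℝ (halfSpace β r₀) :=
  convex_halfSpace_gt β.isLinear r₀

theorem isOpen_halfSpace (β : Heisenberg →L[ℝ] ℝ) (r₀ : ℝ) : IsOpen (halfSpace β r₀) :=
  isOpen_lt continuous_const β.continuous

/-- Poincaré lemma: off the cylinder `B = 0`, so the derivative of the covector field is symmetric.
-/
theorem exists_primitive_on_convex {A : HorizontalOneForm} {B : MagneticField} {r₀ : ℝ}
    (hB : B.SupportedInCylinder r₀) {a₃ : Heisenberg → ℝ} (h₃ : ContDiff ℝ ∞ a₃)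
    (hA : ∀ q, extDeriv (oneForm A.Ax A.Ay a₃) q = B.form q) {s : Set Heisenberg}
    (hs : Convex ℝ s) (hso : IsOpen s) (hout : ∀ q ∈ s, r₀ ^ 2 < q.1 ^ 2 + q.2.1 ^ 2) :
    ∃ f : Heisenberg → ℝ, ∀ q ∈ s, HasFDerivAt f (covector A.Ax A.Ay a₃ q) q := by
  refine hs.exists_forall_hasFDerivAt_of_fderiv_symmetric hso
    ((contDiff_covector A.smoothX A.smoothY h₃).differentiable (by simp)).differentiableOn ?_
  intro q hq v w
  have h := extDeriv_oneForm_apply A.smoothX A.smoothY h₃ q v w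
  rw [hA q, MagneticField.form, horizontalTwoForm_apply,
    (hB.eventually_eq_zero₁ (hout q hq)).self_of_nhds,
    (hB.eventually_eq_zero₂ (hout q hq)).self_of_nhds] at h
  simp at h
  linarith

/-- Green's theorem in the plane `z = 0`, where `B(∂_x, ∂_y) = -½ (x b₁ + y b₂)`, whose integral is
`2π` times the flux. The square is not a horizontal curve, which is why the full representative with
`a₃` is integrated. -/
theorem integral_covector_square {A : HorizontalOneForm} {B : MagneticField} {r₀ : ℝ}
    (hr₀ : 0 ≤ r₀) (hB : B.SupportedInCylinder r₀) {a₃ : Heisenberg → ℝ} (h₃ : ContDiff ℝ ∞ a₃)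
    (hA : ∀ q, extDeriv (oneForm A.Ax A.Ay a₃) q = B.form q) {a : ℝ} (ha : r₀ < a) :
    (((∫ x in (-a)..a, covector A.Ax A.Ay a₃ (x, -a, 0) (1, 0, 0)) -
        ∫ x in (-a)..a, covector A.Ax A.Ay a₃ (x, a, 0) (1, 0, 0)) +
      ∫ y in (-a)..a, covector A.Ax A.Ay a₃ (a, y, 0) (0, 1, 0)) -
        ∫ y in (-a)..a, covector A.Ax A.Ay a₃ (-a, y, 0) (0, 1, 0) =
      2 * Real.pi * B.flux 0 := by
  set α := covector A.Ax A.Ay a₃ with hα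
  have hαs : ContDiff ℝ ∞ α := contDiff_covector A.smoothX A.smoothY h₃
  have hsl : ∀ (x y : ℝ) (w : Heisenberg) (v : ℝ × ℝ),
      fderiv ℝ (fun ξ : ℝ × ℝ => α (ξ.1, ξ.2, 0) w) (x, y) v =
        fderiv ℝ α (x, y, 0) (v.1, v.2, 0) w := by
    intro x y w v
    have h1 : HasFDerivAt (fun ξ : ℝ × ℝ => ((ξ.1, ξ.2, 0) : Heisenberg))
        ((ContinuousLinearMap.fst ℝ ℝ ℝ).prod ((ContinuousLinearMap.snd ℝ ℝ ℝ).prod 0))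
        (x, y) :=
      hasFDerivAt_fst.prodMk (hasFDerivAt_snd.prodMk (hasFDerivAt_const 0 _))
    have h2 := (hαs.differentiable (by simp) (x, y, 0)).hasFDerivAt.comp (x, y) h1
    have h3 := (h2.clm_apply (hasFDerivAt_const w (x, y))).fderiv
    simp only [Function.comp_def] at h3
    rw [h3]
    simp
  have hsm : ∀ w : Heisenberg, ContDiff ℝ 1 (fun ξ : ℝ × ℝ => α (ξ.1, ξ.2, 0) w) := by
    intro w
    have : ContDiff ℝ 1 (fun ξ : ℝ × ℝ => α (ξ.1, ξ.2, 0)) :=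
      (hαs.of_le (by simp)).comp (by fun_prop)
    exact this.clm_apply contDiff_const
  have hgreen := integral_square_curl (hsm (1, 0, 0)) (hsm (0, 1, 0)) a
  rw [← hgreen, hB.flux_eq hr₀,
    integral_plane_eq_intervalIntegral (g := fun ξ => B.radialMoment (ξ.1, ξ.2, 0))
      (B.contDiff_radialMoment.continuous.comp (by fun_prop)) hr₀ ha
      (fun ξ hξ => hB.radialMoment_eq_zero hξ)]
  have hpt : ∀ x y : ℝ, fderiv ℝ α (x, y, 0) (1, 0, 0) (0, 1, 0) -
      fderiv ℝ α (x, y, 0) (0, 1, 0) (1, 0, 0) = -(1 / 2) * B.radialMoment (x, y, 0) := by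
    intro x y
    have h := extDeriv_oneForm_apply A.smoothX A.smoothY h₃ (x, y, 0) (1, 0, 0) (0, 1, 0)
    rw [hA, MagneticField.form, horizontalTwoForm_apply] at h
    simp only [Matrix.cons_val_zero, Matrix.cons_val_one, contactForm_apply] at h
    rw [← h, MagneticField.radialMoment]
    ring
  simp only [hsl, hpt, intervalIntegral.integral_const_mul]
  ring

/-- Local primitives of a vector potential on the four half-spaces `x > r₀`, `y > r₀`, `-x > r₀`,
`-y > r₀`. They differ by constants where they overlap, and the sum of these constants is the
circulation of the potential around the cylinder. -/
theorem exists_local_primitives {A : HorizontalOneForm} {B : MagneticField} {r₀ : ℝ}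
    (hr₀ : 0 ≤ r₀) (hB : B.SupportedInCylinder r₀) {a₃ : Heisenberg → ℝ} (h₃ : ContDiff ℝ ∞ a₃)
    (hA : ∀ q, extDeriv (oneForm A.Ax A.Ay a₃) q = B.form q) :
    ∃ f₁ f₂ f₃ f₄ : Heisenberg → ℝ, ∃ c₁ c₂ c₃ c₄ : ℝ,
      (∀ q ∈ halfSpace dx r₀, HasFDerivAt f₁ (covector A.Ax A.Ay a₃ q) q) ∧
      (∀ q ∈ halfSpace dy r₀, HasFDerivAt f₂ (covector A.Ax A.Ay a₃ q) q) ∧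
      (∀ q ∈ halfSpace (-dx) r₀, HasFDerivAt f₃ (covector A.Ax A.Ay a₃ q) q) ∧
      (∀ q ∈ halfSpace (-dy) r₀, HasFDerivAt f₄ (covector A.Ax A.Ay a₃ q) q) ∧
      (∀ q ∈ halfSpace dx r₀, q ∈ halfSpace dy r₀ → f₁ q - f₂ q = c₁) ∧
      (∀ q ∈ halfSpace dy r₀, q ∈ halfSpace (-dx) r₀ → f₂ q - f₃ q = c₂) ∧
      (∀ q ∈ halfSpace (-dx) r₀, q ∈ halfSpace (-dy) r₀ → f₃ q - f₄ q = c₃) ∧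
      (∀ q ∈ halfSpace (-dy) r₀, q ∈ halfSpace dx r₀ → f₄ q - f₁ q = c₄) ∧
      c₁ + c₂ + c₃ + c₄ = 2 * Real.pi * B.flux 0 := by
  have H := fun (β : Heisenberg →L[ℝ] ℝ) (h : ∀ q ∈ halfSpace β r₀, r₀ ^ 2 < q.1 ^ 2 + q.2.1 ^ 2) =>
    exists_primitive_on_convex hB h₃ hA (convex_halfSpace β r₀) (isOpen_halfSpace β r₀) h
  obtain ⟨f₁, hf₁⟩ := H dx (by
    intro q (hq : r₀ < q.1); nlinarith [sq_nonneg q.2.1])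
  obtain ⟨f₂, hf₂⟩ := H dy (by
    intro q (hq : r₀ < q.2.1); nlinarith [sq_nonneg q.1])
  obtain ⟨f₃, hf₃⟩ := H (-dx) (by
    intro q (hq : r₀ < -q.1); nlinarith [sq_nonneg q.2.1])
  obtain ⟨f₄, hf₄⟩ := H (-dy) (by
    intro q (hq : r₀ < -q.2.1); nlinarith [sq_nonneg q.1])
  have J := fun (β γ : Heisenberg →L[ℝ] ℝ) (f g : Heisenberg → ℝ) =>
    exists_sub_eq_const_of_primitives (f := f) (g := g)
    (α := covector A.Ax A.Ay a₃) (convex_halfSpace β r₀) (isOpen_halfSpace β r₀)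
    (convex_halfSpace γ r₀) (isOpen_halfSpace γ r₀)
  obtain ⟨c₁, hc₁⟩ := J _ _ _ _ hf₁ hf₂
  obtain ⟨c₂, hc₂⟩ := J _ _ _ _ hf₂ hf₃
  obtain ⟨c₃, hc₃⟩ := J _ _ _ _ hf₃ hf₄
  obtain ⟨c₄, hc₄⟩ := J _ _ _ _ hf₄ hf₁
  refine ⟨f₁, f₂, f₃, f₄, c₁, c₂, c₃, c₄, hf₁, hf₂, hf₃, hf₄, hc₁, hc₂, hc₃, hc₄, ?_⟩
  obtain ⟨a, ha⟩ : ∃ a, r₀ < a := ⟨r₀ + 1, lt_add_one r₀⟩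
  have hαc : Continuous (covector A.Ax A.Ay a₃) :=
    (contDiff_covector A.smoothX A.smoothY h₃).continuous
  have edgeX : ∀ (β : Heisenberg →L[ℝ] ℝ) (f : Heisenberg → ℝ) (y : ℝ),
      (∀ q ∈ halfSpace β r₀, HasFDerivAt f (covector A.Ax A.Ay a₃ q) q) →
      (∀ x : ℝ, (x, y, 0) ∈ halfSpace β r₀) →
      ∫ x in (-a)..a, covector A.Ax A.Ay a₃ (x, y, 0) (1, 0, 0) =
        f (a, y, 0) - f (-a, y, 0) := by
    intro β f y hf hmem
    refine intervalIntegral.integral_eq_sub_of_hasDerivAt (f := fun x : ℝ => f (x, y, 0))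
      (fun x _ => ?_)
      (((hαc.comp (by fun_prop)).clm_apply continuous_const).intervalIntegrable _ _)
    exact (hf _ (hmem x)).comp_hasDerivAt x ((hasDerivAt_id x).prodMk (hasDerivAt_const x _))
  have edgeY : ∀ (β : Heisenberg →L[ℝ] ℝ) (f : Heisenberg → ℝ) (x : ℝ),
      (∀ q ∈ halfSpace β r₀, HasFDerivAt f (covector A.Ax A.Ay a₃ q) q) →
      (∀ y : ℝ, (x, y, 0) ∈ halfSpace β r₀) →
      ∫ y in (-a)..a, covector A.Ax A.Ay a₃ (x, y, 0) (0, 1, 0) =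
        f (x, a, 0) - f (x, -a, 0) := by
    intro β f x hf hmem
    refine intervalIntegral.integral_eq_sub_of_hasDerivAt (f := fun y : ℝ => f (x, y, 0))
      (fun y _ => ?_)
      (((hαc.comp (by fun_prop)).clm_apply continuous_const).intervalIntegrable _ _)
    exact (hf _ (hmem y)).comp_hasDerivAt y
      ((hasDerivAt_const y x).prodMk ((hasDerivAt_id y).prodMk (hasDerivAt_const y _)))
  -- Each side of the square lies in one half-space and each corner in the overlap of two, so the
  -- circulation telescopes to the four jumps at the corners.
  have h := integral_covector_square hr₀ hB h₃ hA ha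
  have m : ∀ t : ℝ, (a, t, 0) ∈ halfSpace dx r₀ ∧ (t, a, 0) ∈ halfSpace dy r₀ ∧
      (-a, t, 0) ∈ halfSpace (-dx) r₀ ∧ (t, -a, 0) ∈ halfSpace (-dy) r₀ := by
    intro t
    simp [mem_halfSpace, ha]
  rw [edgeX _ f₄ _ hf₄ fun t => (m t).2.2.2, edgeX _ f₂ _ hf₂ fun t => (m t).2.1,
    edgeY _ f₁ _ hf₁ fun t => (m t).1, edgeY _ f₃ _ hf₃ fun t => (m t).2.2.1] at h
  rw [← h, ← hc₁ (a, a, 0) (m a).1 (m a).2.1, ← hc₂ (-a, a, 0) (m (-a)).2.1 (m a).2.2.1,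
    ← hc₃ (-a, -a, 0) (m (-a)).2.2.1 (m (-a)).2.2.2, ← hc₄ (a, -a, 0) (m a).2.2.2 (m (-a)).1]
  ring

/-- The edges of a figure eight made of two rectangles of width `l` and height `2 * l`: the left
one is traversed counterclockwise, the right one clockwise, so that the enclosed signed area is
zero and the horizontal lift closes up. -/
def figureEight (l : ℝ) : List (ℝ × ℝ) :=
  [(0, l), (-l, 0), (0, -(2 * l)), (l, 0), (0, 2 * l), (l, 0), (0, -(2 * l)), (-l, 0), (0, l)]

theorem endpoint_figureEight (l : ℝ) (q : Heisenberg) : endpoint (figureEight l) q = q := by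
  simp only [endpoint, figureEight, step]
  ext <;> ring

/-- The holonomy of a vector potential around a figure eight with exactly one lobe around the
cylinder is the flux. -/
theorem phase_figureEight {A : HorizontalOneForm} {B : MagneticField} {r₀ : ℝ} (hr₀ : 0 ≤ r₀)
    (hB : B.SupportedInCylinder r₀) (hA : A.IsVectorPotential B) {l : ℝ} {q : Heisenberg}
    (hx : r₀ < q.1) (hxl : r₀ < l - q.1) (hyl : r₀ < l + q.2.1) (hyl' : r₀ < l - q.2.1) :
    A.phase (figureEight l) q = 2 * Real.pi * B.flux 0 := by
  obtain ⟨a₃, h₃, hA⟩ := hA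
  obtain ⟨f₁, f₂, f₃, f₄, c₁, c₂, c₃, c₄, hf₁, hf₂, hf₃, hf₄, hc₁, hc₂, hc₃, hc₄, hc⟩ :=
    exists_local_primitives hr₀ hB h₃ hA
  have hclose := endpoint_figureEight l q
  simp only [HorizontalOneForm.phase, figureEight, endpoint] at hclose ⊢
  set p₁ := step (0, l) q with hp₁
  set p₂ := step (-l, 0) p₁ with hp₂
  set p₃ := step (0, -(2 * l)) p₂ with hp₃
  set p₄ := step (l, 0) p₃ with hp₄
  set p₅ := step (0, 2 * l) p₄ with hp₅
  set p₆ := step (l, 0) p₅ with hp₆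
  set p₇ := step (0, -(2 * l)) p₆ with hp₇
  set p₈ := step (-l, 0) p₇ with hp₈
  have m₀ : q ∈ halfSpace dx r₀ := hx
  have m₁ : p₁ ∈ halfSpace dx r₀ := by
    simp only [mem_halfSpace, dx_apply, hp₁, step]; linarith
  have m₁' : p₁ ∈ halfSpace dy r₀ := by
    simp only [mem_halfSpace, dy_apply, hp₁, step]; linarith
  have m₂ : p₂ ∈ halfSpace dy r₀ := by
    simp only [mem_halfSpace, dy_apply, hp₂, hp₁, step]; linarith
  have m₂' : p₂ ∈ halfSpace (-dx) r₀ := by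
    simp only [mem_halfSpace, neg_apply, dx_apply, hp₂, hp₁, step]; linarith
  have m₃ : p₃ ∈ halfSpace (-dx) r₀ := by
    simp only [mem_halfSpace, neg_apply, dx_apply, hp₃, hp₂, hp₁, step]; linarith
  have m₃' : p₃ ∈ halfSpace (-dy) r₀ := by
    simp only [mem_halfSpace, neg_apply, dy_apply, hp₃, hp₂, hp₁, step]; linarith
  have m₄ : p₄ ∈ halfSpace (-dy) r₀ := by
    simp only [mem_halfSpace, neg_apply, dy_apply, hp₄, hp₃, hp₂, hp₁, step]
    linarith
  have m₄' : p₄ ∈ halfSpace dx r₀ := by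
    simp only [mem_halfSpace, dx_apply, hp₄, hp₃, hp₂, hp₁, step]; linarith
  have m₅ : p₅ ∈ halfSpace dx r₀ := by
    simp only [mem_halfSpace, dx_apply, hp₅, hp₄, hp₃, hp₂, hp₁, step]; linarith
  have m₆ : p₆ ∈ halfSpace dx r₀ := by
    simp only [mem_halfSpace, dx_apply, hp₆, hp₅, hp₄, hp₃, hp₂, hp₁, step]
    linarith
  have m₇ : p₇ ∈ halfSpace dx r₀ := by
    simp only [mem_halfSpace, dx_apply, hp₇, hp₆, hp₅, hp₄, hp₃, hp₂, hp₁, step]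
    linarith
  have m₈ : p₈ ∈ halfSpace dx r₀ := by
    simp only [mem_halfSpace, dx_apply, hp₈, hp₇, hp₆, hp₅, hp₄, hp₃, hp₂, hp₁,
      step]
    linarith
  -- The first four edges run through the half-spaces around the cylinder, changing primitive at
  -- corners in the overlaps; the remaining five stay in `x > r₀`. The sum telescopes to the four
  -- jumps.
  have C := fun β => convex_halfSpace β r₀
  rw [A.segmentPhase_eq_of_primitive h₃ (C _) hf₁ m₀ m₁,
    A.segmentPhase_eq_of_primitive h₃ (C _) hf₂ m₁' m₂,
    A.segmentPhase_eq_of_primitive h₃ (C _) hf₃ m₂' m₃,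
    A.segmentPhase_eq_of_primitive h₃ (C _) hf₄ m₃' m₄,
    A.segmentPhase_eq_of_primitive h₃ (C _) hf₁ m₄' m₅,
    A.segmentPhase_eq_of_primitive h₃ (C _) hf₁ m₅ m₆,
    A.segmentPhase_eq_of_primitive h₃ (C _) hf₁ m₆ m₇,
    A.segmentPhase_eq_of_primitive h₃ (C _) hf₁ m₇ m₈,
    A.segmentPhase_eq_of_primitive h₃ (C _) hf₁ m₈ (hclose ▸ m₀), hclose, ← hc,
    ← hc₁ _ m₁ m₁', ← hc₂ _ m₂ m₂', ← hc₃ _ m₃ m₃', ← hc₄ _ m₄ m₄']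
  simp only [← hp₁, ← hp₂, ← hp₃, ← hp₄, ← hp₅, ← hp₆, ← hp₇, ← hp₈]
  ring

/-! ### Translation invariance and parallel transport. -/

theorem continuous_step (v : ℝ × ℝ) : Continuous (step v) := by
  unfold step
  fun_prop

/-- The translation is triangular: `x` is shifted, then `y`, then `z` by an amount depending only on
`x` and `y`. Two applications of the skew product suffice. -/
theorem measurePreserving_step (v : ℝ × ℝ) :
    MeasurePreserving (step v) (volume : Measure Heisenberg) volume := by
  have inner : ∀ x : ℝ, MeasurePreserving
      (fun p : ℝ × ℝ => (p.1 + v.2, p.2 + (x * v.2 - p.1 * v.1) / 2))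
      ((volume : Measure ℝ).prod volume) ((volume : Measure ℝ).prod volume) := by
    intro x
    refine MeasurePreserving.skew_product (g := fun y z => z + (x * v.2 - y * v.1) / 2)
      (measurePreserving_add_right volume v.2) ?_ ?_
    · exact Continuous.measurable (by unfold Function.uncurry; fun_prop)
    · exact Eventually.of_forall fun y => (measurePreserving_add_right volume _).map_eq
  refine MeasurePreserving.skew_product
    (g := fun (x : ℝ) (p : ℝ × ℝ) => (p.1 + v.2, p.2 + (x * v.2 - p.1 * v.1) / 2))
    (measurePreserving_add_right volume v.1) ?_ ?_
  · exact Continuous.measurable (by unfold Function.uncurry; fun_prop)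
  · exact Eventually.of_forall fun x => (inner x).map_eq

theorem continuous_endpoint (w : List (ℝ × ℝ)) : Continuous (endpoint w) := by
  induction w with
  | nil => exact continuous_id
  | cons v w ih => exact ih.comp (continuous_step v)

theorem measurePreserving_endpoint (w : List (ℝ × ℝ)) :
    MeasurePreserving (endpoint w) (volume : Measure Heisenberg) volume := by
  induction w with
  | nil => exact MeasurePreserving.id _
  | cons v w ih => exact ih.comp (measurePreserving_step v)

/-- The horizontal path from `q` with edges `w` does not leave `N`. -/
def StaysIn (N : Set Heisenberg) : List (ℝ × ℝ) → Heisenberg → Prop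
  | [], _ => True
  | v :: w, q => (∀ t ∈ Set.Icc (0 : ℝ) 1, step (t • v) q ∈ N) ∧ StaysIn N w (step v q)

/-- The constant in the transport inequality for paths with edges `w`. -/
def transportCost : List (ℝ × ℝ) → ℝ
  | [] => 0
  | v :: w => 2 * (v.1 ^ 2 + v.2 ^ 2) + 2 * transportCost w

theorem transportCost_nonneg (w : List (ℝ × ℝ)) : 0 ≤ transportCost w := by
  induction w with
  | nil => exact le_rfl
  | cons v w ih => simp only [transportCost]; positivity

/-- The difference of the two sides is the variance of `f` on the unit interval. -/
theorem sq_intervalIntegral_le {f : ℝ → ℝ} (hf : Continuous f) :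
    (∫ t in (0 : ℝ)..1, f t) ^ 2 ≤ ∫ t in (0 : ℝ)..1, f t ^ 2 := by
  set m := ∫ t in (0 : ℝ)..1, f t with hm
  have h0 : 0 ≤ ∫ t in (0 : ℝ)..1, (f t - m) ^ 2 :=
    intervalIntegral.integral_nonneg zero_le_one fun t _ => sq_nonneg _
  have h1 : ∫ t in (0 : ℝ)..1, (f t - m) ^ 2 =
      (∫ t in (0 : ℝ)..1, f t ^ 2) - (∫ t in (0 : ℝ)..1, 2 * m * f t) +
        ∫ t in (0 : ℝ)..1, m ^ 2 := by
    have i1 : IntervalIntegrable (fun t => f t ^ 2) volume 0 1 :=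
      (hf.pow 2).intervalIntegrable _ _
    have i2 : IntervalIntegrable (fun t => 2 * m * f t) volume 0 1 :=
      (hf.const_mul (2 * m)).intervalIntegrable _ _
    rw [← intervalIntegral.integral_sub i1 i2, ← intervalIntegral.integral_add (i1.sub i2)
      (continuous_const.intervalIntegrable _ _)]
    exact intervalIntegral.integral_congr fun t _ => by ring
  rw [h1, intervalIntegral.integral_const_mul, ← hm, intervalIntegral.integral_const] at h0
  simp at h0
  nlinarith

namespace HorizontalOneForm

variable (A : HorizontalOneForm) {u : Heisenberg → ℂ}

/-- The integrand `‖(d_H + i A) u‖²` of the energy. -/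
def energyDensity (u : Heisenberg → ℂ) (q : Heisenberg) : ℝ := ‖A.covX u q‖ ^ 2 + ‖A.covY u q‖ ^ 2

theorem energyDensity_nonneg (u : Heisenberg → ℂ) (q : Heisenberg) : 0 ≤ A.energyDensity u q := by
  unfold energyDensity
  positivity

theorem continuous_covX (hu : ContDiff ℝ ∞ u) : Continuous (A.covX u) := by
  have h1 : Continuous (fun q => fderiv ℝ u q (fieldX q)) :=
    (hu.continuous_fderiv (by simp)).clm_apply (by unfold fieldX; fun_prop)
  have h2 := A.smoothX.continuous
  have h3 := hu.continuous
  unfold covX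
  fun_prop

theorem continuous_covY (hu : ContDiff ℝ ∞ u) : Continuous (A.covY u) := by
  have h1 : Continuous (fun q => fderiv ℝ u q (fieldY q)) :=
    (hu.continuous_fderiv (by simp)).clm_apply (by unfold fieldY; fun_prop)
  have h2 := A.smoothY.continuous
  have h3 := hu.continuous
  unfold covY
  fun_prop

theorem continuous_energyDensity (hu : ContDiff ℝ ∞ u) : Continuous (A.energyDensity u) := by
  have h1 := A.continuous_covX hu
  have h2 := A.continuous_covY hu
  unfold energyDensity
  fun_prop

theorem continuous_segment_integrand (v : ℝ × ℝ) :
    Continuous (Function.uncurry fun (q : Heisenberg) (t : ℝ) =>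
      v.1 * A.Ax (step (t • v) q) + v.2 * A.Ay (step (t • v) q)) := by
  have h1 := A.smoothX.continuous
  have h2 := A.smoothY.continuous
  unfold Function.uncurry step
  fun_prop

theorem continuous_segmentPhase (v : ℝ × ℝ) : Continuous (A.segmentPhase v) :=
  intervalIntegral.continuous_parametric_intervalIntegral_of_continuous'
    (A.continuous_segment_integrand v) 0 1

/-- Parallel transport along a horizontal segment. -/
theorem sq_norm_segment_transport_le (hu : ContDiff ℝ ∞ u) (v : ℝ × ℝ) (q : Heisenberg) :
    ‖Complex.exp (A.segmentPhase v q * Complex.I) * u (step v q) - u q‖ ^ 2 ≤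
      ∫ t in (0 : ℝ)..1, (v.1 ^ 2 + v.2 ^ 2) * A.energyDensity u (step (t • v) q) := by
  have hγ : Continuous fun t : ℝ => step (t • v) q := by
    unfold step
    fun_prop
  set a : ℝ → ℝ := fun t => v.1 * A.Ax (step (t • v) q) + v.2 * A.Ay (step (t • v) q) with ha
  have hac : Continuous a := by
    have h1 := A.smoothX.continuous
    have h2 := A.smoothY.continuous
    fun_prop
  set D : ℝ → ℂ := fun t => v.1 * A.covX u (step (t • v) q) + v.2 * A.covY u (step (t • v) q)
    with hD
  have hDc : Continuous D := by
    have h1 := A.continuous_covX hu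
    have h2 := A.continuous_covY hu
    fun_prop
  set Θ : ℝ → ℝ := fun t => ∫ s in (0 : ℝ)..t, a s with hΘ
  have hΘd : ∀ t, HasDerivAt Θ (a t) t := fun t =>
    intervalIntegral.integral_hasDerivAt_right (hac.intervalIntegrable _ _)
      hac.stronglyMeasurable.stronglyMeasurableAtFilter hac.continuousAt
  have hΘc : Continuous Θ := continuous_iff_continuousAt.2 fun t => (hΘd t).continuousAt
  set E : ℝ → ℂ := fun t => Complex.exp (Θ t * Complex.I) with hE
  have hEc : Continuous E := by fun_prop
  -- The factor `E` gauges the potential away along the segment: the ordinary derivative becomes the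
  -- covariant one, up to a unimodular factor.
  have hder : ∀ t, HasDerivAt (fun s => E s * u (step (s • v) q)) (E t * D t) t := by
    intro t
    have h1 : HasDerivAt E (E t * (a t * Complex.I)) t :=
      ((hΘd t).ofReal_comp.mul_const Complex.I).cexp
    have h2 : HasDerivAt (fun s : ℝ => u (step (s • v) q))
        (fderiv ℝ u (step (t • v) q) (velocity v q)) t :=
      (hu.differentiable (by simp) _).hasFDerivAt.comp_hasDerivAt t (hasDerivAt_step_smul t v q)
    refine (h1.mul h2).congr_deriv ?_
    rw [velocity_eq t v q, map_add, map_smul, map_smul]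
    simp only [hD, ha, covX, covY, Complex.real_smul]
    push_cast
    ring
  have hftc := intervalIntegral.integral_eq_sub_of_hasDerivAt (a := (0 : ℝ)) (b := 1)
    (fun t _ => hder t) ((hEc.mul hDc).intervalIntegrable _ _)
  have hends : ∫ t in (0 : ℝ)..1, E t * D t =
      Complex.exp (A.segmentPhase v q * Complex.I) * u (step v q) - u q := by
    rw [hftc]
    simp [hE, hΘ, segmentPhase, ha]
  have hEn : ∀ t, ‖E t‖ = 1 := fun t => Complex.norm_exp_ofReal_mul_I _
  rw [← hends]
  calc ‖∫ t in (0 : ℝ)..1, E t * D t‖ ^ 2 ≤ (∫ t in (0 : ℝ)..1, ‖D t‖) ^ 2 := by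
        gcongr
        refine (intervalIntegral.norm_integral_le_integral_norm zero_le_one).trans_eq ?_
        simp only [norm_mul, hEn, one_mul]
    _ ≤ ∫ t in (0 : ℝ)..1, ‖D t‖ ^ 2 := sq_intervalIntegral_le hDc.norm
    _ ≤ _ := by
        refine intervalIntegral.integral_mono_on zero_le_one
          ((hDc.norm.pow 2).intervalIntegrable _ _)
          ((((A.continuous_energyDensity hu).comp hγ).const_mul _).intervalIntegrable _ _)
          fun t _ => ?_
        set x := A.covX u (step (t • v) q) with hx
        set y := A.covY u (step (t • v) q) with hy
        have h1 : ‖D t‖ ≤ |v.1| * ‖x‖ + |v.2| * ‖y‖ := by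
          refine (norm_add_le _ _).trans_eq ?_
          simp [hx, hy]
        have h2 : ‖D t‖ ^ 2 ≤ (|v.1| * ‖x‖ + |v.2| * ‖y‖) ^ 2 := by gcongr
        refine h2.trans ?_
        simp only [energyDensity, ← hx, ← hy]
        rw [← sq_abs v.1, ← sq_abs v.2]
        nlinarith [sq_nonneg (|v.1| * ‖y‖ - |v.2| * ‖x‖)]

/-- The transport inequality along a segment, integrated over a set of starting points. -/
theorem lintegral_segment_transport_le (hu : ContDiff ℝ ∞ u) {S N : Set Heisenberg}
    (hS : MeasurableSet S) (hN : MeasurableSet N) {e : Heisenberg → Heisenberg}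
    (he : MeasurePreserving e volume volume) (hec : Continuous e) (v : ℝ × ℝ)
    (h : ∀ p ∈ S, ∀ t ∈ Set.Icc (0 : ℝ) 1, step (t • v) (e p) ∈ N) :
    ∫⁻ p in S, ENNReal.ofReal
      (‖Complex.exp (A.segmentPhase v (e p) * Complex.I) * u (step v (e p)) - u (e p)‖ ^ 2) ≤
      ENNReal.ofReal (v.1 ^ 2 + v.2 ^ 2) * ∫⁻ q in N, ENNReal.ofReal (A.energyDensity u q) := by
  have hG := A.continuous_energyDensity hu
  have hGm : Measurable fun q => ENNReal.ofReal (A.energyDensity u q) :=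
    ENNReal.measurable_ofReal.comp hG.measurable
  set K := ENNReal.ofReal (v.1 ^ 2 + v.2 ^ 2) with hK
  have hjc : Continuous fun z : Heisenberg × ℝ => step (z.2 • v) (e z.1) := by
    have h1 : Continuous fun z : ℝ × Heisenberg => step (z.1 • v) z.2 := by
      unfold step
      fun_prop
    exact h1.comp (by fun_prop : Continuous fun z : Heisenberg × ℝ => (z.2, e z.1))
  calc _ ≤ ∫⁻ p in S, ∫⁻ t in Set.Ioc (0 : ℝ) 1,
        K * ENNReal.ofReal (A.energyDensity u (step (t • v) (e p))) := by
        refine lintegral_mono fun p => ?_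
        refine (ENNReal.ofReal_le_ofReal (A.sq_norm_segment_transport_le hu v (e p))).trans_eq ?_
        have hc : Continuous fun t : ℝ =>
            (v.1 ^ 2 + v.2 ^ 2) * A.energyDensity u (step (t • v) (e p)) :=
          (hG.comp (hjc.comp (by fun_prop : Continuous fun t : ℝ => (p, t)))).const_mul _
        rw [intervalIntegral.integral_of_le zero_le_one, ofReal_integral_eq_lintegral_ofReal]
        · simp only [hK, ENNReal.ofReal_mul (show 0 ≤ v.1 ^ 2 + v.2 ^ 2 by positivity)]
        · exact (hc.intervalIntegrable 0 1).1
        · exact Eventually.of_forall fun t =>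
            mul_nonneg (by positivity) (A.energyDensity_nonneg u _)
    _ = ∫⁻ t in Set.Ioc (0 : ℝ) 1, ∫⁻ p in S,
        K * ENNReal.ofReal (A.energyDensity u (step (t • v) (e p))) := by
        refine lintegral_lintegral_swap (Measurable.aemeasurable ?_)
        exact (hGm.comp hjc.measurable).const_mul K
    _ ≤ ∫⁻ t in Set.Ioc (0 : ℝ) 1, K * ∫⁻ q in N, ENNReal.ofReal (A.energyDensity u q) := by
        refine setLIntegral_mono' measurableSet_Ioc fun t ht => ?_
        rw [lintegral_const_mul' _ _ ENNReal.ofReal_ne_top]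
        refine mul_le_mul' le_rfl ?_
        -- At fixed `t` the map `p ↦ step (t • v) (e p)` preserves measure and sends `S` into `N`,
        -- so the energy over its image is at most the energy over `N`.
        rw [← lintegral_indicator hN,
          ← ((measurePreserving_step (t • v)).comp he).lintegral_comp (hGm.indicator hN)]
        refine (setLIntegral_mono' hS fun p hp => ?_).trans (setLIntegral_le_lintegral S _)
        rw [Function.comp_apply, Set.indicator_of_mem (h p hp t (Set.Ioc_subset_Icc_self ht))]
    _ = _ := by simp

/-- The transport inequality along a polygonal horizontal path, integrated over a set of starting
points. -/
theorem lintegral_transport_le (hu : ContDiff ℝ ∞ u) {S N : Set Heisenberg}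
    (hS : MeasurableSet S) (hN : MeasurableSet N) (w : List (ℝ × ℝ))
    {e : Heisenberg → Heisenberg} (he : MeasurePreserving e volume volume) (hec : Continuous e)
    (h : ∀ p ∈ S, StaysIn N w (e p)) :
    ∫⁻ p in S, ENNReal.ofReal
      (‖Complex.exp (A.phase w (e p) * Complex.I) * u (endpoint w (e p)) - u (e p)‖ ^ 2) ≤
      ENNReal.ofReal (transportCost w) * ∫⁻ q in N, ENNReal.ofReal (A.energyDensity u q) := by
  -- The map `e` records the part of the path already travelled. The factors `2` in `transportCost`
  -- come from `‖a + b‖² ≤ 2‖a‖² + 2‖b‖²` at each edge.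
  induction w generalizing e with
  | nil => simp [phase, endpoint]
  | cons v w ih =>
    have h1 := A.lintegral_segment_transport_le hu hS hN he hec v fun p hp => (h p hp).1
    have h2 := ih ((measurePreserving_step v).comp he) ((continuous_step v).comp hec)
      fun p hp => (h p hp).2
    simp only [Function.comp_apply] at h2
    have hm : Measurable fun p => 2 * ENNReal.ofReal
        (‖Complex.exp (A.segmentPhase v (e p) * Complex.I) * u (step v (e p)) - u (e p)‖ ^ 2) := by
      refine (ENNReal.measurable_ofReal.comp (Continuous.measurable ?_)).const_mul 2
      have c1 := A.continuous_segmentPhase v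
      have c2 := continuous_step v
      have c3 := hu.continuous
      fun_prop
    calc _ ≤ ∫⁻ p in S, (2 * ENNReal.ofReal (‖Complex.exp (A.segmentPhase v (e p) * Complex.I) *
            u (step v (e p)) - u (e p)‖ ^ 2) +
          2 * ENNReal.ofReal (‖Complex.exp (A.phase w (step v (e p)) * Complex.I) *
            u (endpoint w (step v (e p))) - u (step v (e p))‖ ^ 2)) := by
          refine lintegral_mono fun p => ?_
          rw [show (2 : ENNReal) = ENNReal.ofReal 2 by simp, ← ENNReal.ofReal_mul zero_le_two,
            ← ENNReal.ofReal_mul zero_le_two, ← ENNReal.ofReal_add (by positivity) (by positivity)]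
          refine ENNReal.ofReal_le_ofReal ?_
          simp only [phase, endpoint]
          set a := Complex.exp (A.segmentPhase v (e p) * Complex.I) * u (step v (e p)) - u (e p)
          set b := Complex.exp (A.phase w (step v (e p)) * Complex.I) *
            u (endpoint w (step v (e p))) - u (step v (e p))
          have hsum : Complex.exp (((A.segmentPhase v (e p) + A.phase w (step v (e p)) : ℝ) : ℂ) *
              Complex.I) * u (endpoint w (step v (e p))) - u (e p) =
              a + Complex.exp (A.segmentPhase v (e p) * Complex.I) * b := by
            push_cast
            rw [add_mul, Complex.exp_add]
            ring
          rw [hsum]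
          have hn : ‖a + Complex.exp (A.segmentPhase v (e p) * Complex.I) * b‖ ≤ ‖a‖ + ‖b‖ := by
            refine (norm_add_le _ _).trans_eq ?_
            rw [norm_mul, Complex.norm_exp_ofReal_mul_I, one_mul]
          have hsq := pow_le_pow_left₀ (norm_nonneg _) hn 2
          nlinarith [sq_nonneg (‖a‖ - ‖b‖)]
      _ ≤ 2 * (ENNReal.ofReal (v.1 ^ 2 + v.2 ^ 2) *
            ∫⁻ q in N, ENNReal.ofReal (A.energyDensity u q)) +
          2 * (ENNReal.ofReal (transportCost w) *
            ∫⁻ q in N, ENNReal.ofReal (A.energyDensity u q)) := by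
          rw [lintegral_add_left hm, lintegral_const_mul' _ _ ENNReal.ofNat_ne_top,
            lintegral_const_mul' _ _ ENNReal.ofNat_ne_top]
          gcongr
      _ = _ := by
          have := transportCost_nonneg w
          rw [transportCost, ENNReal.ofReal_add (p := 2 * (v.1 ^ 2 + v.2 ^ 2)) (by positivity)
            (by positivity),
            ENNReal.ofReal_mul zero_le_two, ENNReal.ofReal_mul zero_le_two, ENNReal.ofReal_ofNat]
          ring

end HorizontalOneForm

/-! ### Local Hardy inequalities. -/

/-- A cylindrical shell of scale `l`. -/
def shell (l : ℝ) : Set Heisenberg :=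
  {q | l ^ 2 ≤ 4 * (q.1 ^ 2 + q.2.1 ^ 2) ∧ q.1 ^ 2 + q.2.1 ^ 2 ≤ 10000 * l ^ 2}

/-- The dyadic shell `l ≤ r ≤ 2 l`. -/
def annulus (l : ℝ) : Set Heisenberg :=
  {q | l ^ 2 ≤ q.1 ^ 2 + q.2.1 ^ 2 ∧ q.1 ^ 2 + q.2.1 ^ 2 ≤ 4 * l ^ 2}

/-- The box from which figure eights of size `8 * l` go once around the cylinder. -/
def basePrism (l : ℝ) : Set Heisenberg :=
  {q | (2 * l ≤ q.1 ∧ q.1 ≤ 6 * l) ∧ -(2 * l) ≤ q.2.1 ∧ q.2.1 ≤ 6 * l}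

theorem measurableSet_shell (l : ℝ) : MeasurableSet (shell l) := by
  unfold shell
  measurability

theorem measurableSet_annulus (l : ℝ) : MeasurableSet (annulus l) := by
  unfold annulus
  measurability

theorem measurableSet_basePrism (l : ℝ) : MeasurableSet (basePrism l) := by
  unfold basePrism
  measurability

theorem measurableSet_cylinder (l : ℝ) : MeasurableSet (cylinder l) :=
  (isClosed_le (by fun_prop) (by fun_prop)).measurableSet

theorem mem_shell_of_bounds {l x y z : ℝ} (hl : 0 < l)
    (h : l / 2 ≤ x ∨ x ≤ -(l / 2) ∨ l / 2 ≤ y ∨ y ≤ -(l / 2))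
    (hx : -(50 * l) ≤ x) (hx' : x ≤ 50 * l) (hy : -(50 * l) ≤ y) (hy' : y ≤ 50 * l) :
    ((x, y, z) : Heisenberg) ∈ shell l := by
  refine ⟨?_, ?_⟩
  · rcases h with h | h | h | h <;> nlinarith [sq_nonneg x, sq_nonneg y]
  · have h1 : x ^ 2 ≤ (50 * l) ^ 2 := sq_le_sq' hx hx'
    have h2 : y ^ 2 ≤ (50 * l) ^ 2 := sq_le_sq' hy hy'
    change x ^ 2 + y ^ 2 ≤ 10000 * l ^ 2
    nlinarith [sq_nonneg l]

/-- Every edge is parallel to an axis in projection, and its constant coordinate has absolute value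
at least `2 * l`. All coordinates stay below `14 * l` in absolute value, well within the shell. -/
theorem staysIn_figureEight {l : ℝ} (hl : 0 < l) {q : Heisenberg} (hq : q ∈ basePrism l) :
    StaysIn (shell l) (figureEight (8 * l)) q := by
  obtain ⟨⟨hx, hx'⟩, hy, hy'⟩ := hq
  simp only [figureEight, StaysIn, and_true]
  refine ⟨?_, ?_, ?_, ?_, ?_, ?_, ?_, ?_, ?_⟩ <;> intro t ht <;>
    have h0 : 0 ≤ t * l := mul_nonneg ht.1 hl.le <;>
    have h1 : t * l ≤ l := mul_le_of_le_one_left hl.le ht.2 <;>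
    simp only [step, Prod.smul_mk, smul_eq_mul] <;>
    apply mem_shell_of_bounds hl <;> first
      | linarith
      | (left; linarith)
      | (right; left; linarith)
      | (right; right; left; linarith)
      | (right; right; right; linarith)

theorem transportCost_figureEight (l : ℝ) : transportCost (figureEight (8 * l)) = 97664 * l ^ 2 := by
  simp only [transportCost, figureEight]
  ring

namespace HorizontalOneForm

variable (A : HorizontalOneForm) {u : Heisenberg → ℂ}

/-- Transfers a bound on `u` from `R` to `S`. Only moduli matter, so the unimodular phase drops out
and the path may be open and may cross the support of `B`. -/
theorem lintegral_sq_le_of_path (hu : ContDiff ℝ ∞ u) {S N R : Set Heisenberg}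
    (hS : MeasurableSet S) (hN : MeasurableSet N) (hR : MeasurableSet R) (w : List (ℝ × ℝ))
    (hSN : ∀ p ∈ S, StaysIn N w p) (hSR : ∀ p ∈ S, endpoint w p ∈ R) :
    ∫⁻ p in S, ENNReal.ofReal (‖u p‖ ^ 2) ≤
      2 * (ENNReal.ofReal (transportCost w) * ∫⁻ q in N, ENNReal.ofReal (A.energyDensity u q)) +
        2 * ∫⁻ q in R, ENNReal.ofReal (‖u q‖ ^ 2) := by
  have hm : Measurable fun p => ENNReal.ofReal (‖u p‖ ^ 2) :=
    ENNReal.measurable_ofReal.comp (hu.continuous.norm.pow 2).measurable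
  have h1 := A.lintegral_transport_le hu hS hN w (MeasurePreserving.id _) continuous_id hSN
  simp only [id_eq] at h1
  have h2 : ∫⁻ p in S, ENNReal.ofReal (‖u (endpoint w p)‖ ^ 2) ≤
      ∫⁻ q in R, ENNReal.ofReal (‖u q‖ ^ 2) := by
    rw [← lintegral_indicator hR, ← (measurePreserving_endpoint w).lintegral_comp (hm.indicator hR)]
    refine (setLIntegral_mono' hS fun p hp => ?_).trans (setLIntegral_le_lintegral S _)
    rw [Set.indicator_of_mem (hSR p hp)]
  calc _ ≤ ∫⁻ p in S, (2 * ENNReal.ofReal (‖Complex.exp (A.phase w p * Complex.I) *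
            u (endpoint w p) - u p‖ ^ 2) + 2 * ENNReal.ofReal (‖u (endpoint w p)‖ ^ 2)) := by
        refine lintegral_mono fun p => ?_
        rw [show (2 : ENNReal) = ENNReal.ofReal 2 by simp, ← ENNReal.ofReal_mul zero_le_two,
          ← ENNReal.ofReal_mul zero_le_two, ← ENNReal.ofReal_add (by positivity) (by positivity)]
        refine ENNReal.ofReal_le_ofReal ?_
        have hn : ‖u p‖ ≤ ‖Complex.exp (A.phase w p * Complex.I) * u (endpoint w p) - u p‖ +
            ‖u (endpoint w p)‖ := by
          have := norm_sub_le (Complex.exp (A.phase w p * Complex.I) * u (endpoint w p))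
            (Complex.exp (A.phase w p * Complex.I) * u (endpoint w p) - u p)
          rw [sub_sub_cancel, norm_mul, Complex.norm_exp_ofReal_mul_I, one_mul] at this
          linarith
        have hsq := pow_le_pow_left₀ (norm_nonneg _) hn 2
        nlinarith [sq_nonneg (‖Complex.exp (A.phase w p * Complex.I) * u (endpoint w p) - u p‖ -
            ‖u (endpoint w p)‖)]
    _ ≤ _ := by
        have hm' : Measurable fun p => 2 * ENNReal.ofReal (‖u (endpoint w p)‖ ^ 2) :=
          (hm.comp (continuous_endpoint w).measurable).const_mul 2
        rw [lintegral_add_right _ hm',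
          lintegral_const_mul' _ _ ENNReal.ofNat_ne_top,
          lintegral_const_mul' _ _ ENNReal.ofNat_ne_top]
        gcongr

variable {A} {B : MagneticField} {r₀ : ℝ}

/-- The constant `‖e^{2πiF} - 1‖²`, which vanishes exactly when the flux `F` is an integer. -/
def holonomyGap (F : ℝ) : ℝ := ‖Complex.exp ((2 * Real.pi * F : ℝ) * Complex.I) - 1‖ ^ 2

theorem holonomyGap_pos {F : ℝ} (hF : ∀ n : ℤ, F ≠ n) : 0 < holonomyGap F := by
  refine pow_pos (norm_pos_iff.2 fun h => ?_) 2
  obtain ⟨n, hn⟩ := Complex.exp_eq_one_iff.1 (sub_eq_zero.1 h)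
  refine hF n ?_
  have h1 : ((2 * Real.pi * F : ℝ) : ℂ) = ((n * (2 * Real.pi) : ℝ) : ℂ) := by
    apply mul_right_cancel₀ Complex.I_ne_zero
    rw [hn]
    push_cast
    ring
  have h2 := Complex.ofReal_injective h1
  have := Real.pi_pos
  nlinarith [mul_left_cancel₀ (show 2 * Real.pi ≠ 0 by positivity)
    (show 2 * Real.pi * F = 2 * Real.pi * n by linarith)]

/-- The only place where the flux controls `u`: transport around the closed figure eight returns
`e^{2πiF} u(q)`, so its defect has squared modulus `holonomyGap` times `‖u q‖²`. -/
theorem lintegral_basePrism_le (hr₀ : 0 ≤ r₀) (hB : B.SupportedInCylinder r₀)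
    (hA : A.IsVectorPotential B) (hgap : 0 < holonomyGap (B.flux 0)) (hu : ContDiff ℝ ∞ u) {l : ℝ}
    (hl : 0 < l) (hlr : r₀ < l) :
    ∫⁻ q in basePrism l, ENNReal.ofReal (‖u q‖ ^ 2) ≤
      ENNReal.ofReal (97664 / holonomyGap (B.flux 0) * l ^ 2) *
        ∫⁻ q in shell l, ENNReal.ofReal (A.energyDensity u q) := by
  set δ := holonomyGap (B.flux 0) with hδ
  have h := A.lintegral_transport_le hu (measurableSet_basePrism l) (measurableSet_shell l)
    (figureEight (8 * l)) (MeasurePreserving.id _) continuous_id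
    (fun p hp => staysIn_figureEight hl hp)
  rw [transportCost_figureEight] at h
  have heq : ∫⁻ p in basePrism l, ENNReal.ofReal (‖Complex.exp (A.phase (figureEight (8 * l))
      (id p) * Complex.I) * u (endpoint (figureEight (8 * l)) (id p)) - u (id p)‖ ^ 2) =
      ENNReal.ofReal δ * ∫⁻ q in basePrism l, ENNReal.ofReal (‖u q‖ ^ 2) := by
    rw [← lintegral_const_mul' _ _ ENNReal.ofReal_ne_top]
    refine setLIntegral_congr_fun (measurableSet_basePrism l) fun p hp => ?_
    obtain ⟨⟨hx, hx'⟩, hy, hy'⟩ := hp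
    simp only [id_eq]
    rw [endpoint_figureEight, phase_figureEight hr₀ hB hA (by linarith) (by linarith)
      (by linarith) (by linarith), ← sub_one_mul, norm_mul, mul_pow,
      ENNReal.ofReal_mul (by positivity), hδ, holonomyGap]
  rw [heq] at h
  calc _ = ENNReal.ofReal δ⁻¹ * (ENNReal.ofReal δ *
        ∫⁻ q in basePrism l, ENNReal.ofReal (‖u q‖ ^ 2)) := by
        rw [← mul_assoc, ← ENNReal.ofReal_mul (by positivity), inv_mul_cancel₀ hgap.ne']
        simp
    _ ≤ ENNReal.ofReal δ⁻¹ * (ENNReal.ofReal (97664 * l ^ 2) *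
        ∫⁻ q in shell l, ENNReal.ofReal (A.energyDensity u q)) := by gcongr
    _ = _ := by
        rw [← mul_assoc, ← ENNReal.ofReal_mul (by positivity)]
        congr 2
        field_simp

/-- The constant in the local Hardy inequalities. -/
def localHardyConst (F : ℝ) : ℝ := 256 + 390656 / holonomyGap F

/-- The annulus is moved into `basePrism` without approaching the axis: `S₁` goes right directly,
while `S₂`, to the left of the axis, first goes up. The box is sized to receive both images. -/
theorem lintegral_annulus_le (hr₀ : 0 ≤ r₀) (hB : B.SupportedInCylinder r₀)
    (hA : A.IsVectorPotential B) (hgap : 0 < holonomyGap (B.flux 0)) (hu : ContDiff ℝ ∞ u) {l : ℝ}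
    (hl : 0 < l) (hlr : r₀ < l) :
    ∫⁻ q in annulus l, ENNReal.ofReal (‖u q‖ ^ 2) ≤
      ENNReal.ofReal (localHardyConst (B.flux 0) * l ^ 2) *
        ∫⁻ q in shell l, ENNReal.ofReal (A.energyDensity u q) := by
  set S₁ : Set Heisenberg := annulus l ∩ {q | l / 2 ≤ q.1 ∨ l / 2 ≤ q.2.1 ∨ q.2.1 ≤ -(l / 2)}
    with hS₁
  set S₂ : Set Heisenberg := annulus l ∩ {q | q.1 ≤ -(l / 2)} with hS₂
  have hm₁ : MeasurableSet S₁ := (measurableSet_annulus l).inter (by measurability)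
  have hm₂ : MeasurableSet S₂ := (measurableSet_annulus l).inter
    (isClosed_le (by fun_prop) (by fun_prop)).measurableSet
  have hcov : annulus l ⊆ S₁ ∪ S₂ := by
    intro q hq
    by_cases h1 : l / 2 ≤ q.1
    · exact Or.inl ⟨hq, Or.inl h1⟩
    by_cases h2 : q.1 ≤ -(l / 2)
    · exact Or.inr ⟨hq, h2⟩
    refine Or.inl ⟨hq, Or.inr ?_⟩
    by_contra! h3
    push Not at h1 h2
    -- Otherwise both planar coordinates are below `l / 2` in absolute value, and `r² < l² / 2`.
    nlinarith [hq.1]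
  have hbd : ∀ q ∈ annulus l, (-(2 * l) ≤ q.1 ∧ q.1 ≤ 2 * l) ∧
      -(2 * l) ≤ q.2.1 ∧ q.2.1 ≤ 2 * l := by
    intro q hq
    have h1 : |q.1| ≤ 2 * l :=
      abs_le_of_sq_le_sq (by nlinarith [hq.2, sq_nonneg q.2.1]) (by linarith)
    have h2 : |q.2.1| ≤ 2 * l :=
      abs_le_of_sq_le_sq (by nlinarith [hq.2, sq_nonneg q.1]) (by linarith)
    exact ⟨abs_le.1 h1, abs_le.1 h2⟩
  have ht : ∀ t ∈ Set.Icc (0 : ℝ) 1, 0 ≤ t * l ∧ t * l ≤ l := fun t ht =>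
    ⟨mul_nonneg ht.1 hl.le, mul_le_of_le_one_left hl.le ht.2⟩
  have e₁ := A.lintegral_sq_le_of_path hu hm₁ (measurableSet_shell l) (measurableSet_basePrism l)
    [(4 * l, 0)] (by
      intro q hq
      obtain ⟨⟨hx, hx'⟩, hy, hy'⟩ := hbd q hq.1
      refine ⟨fun t htm => ?_, trivial⟩
      obtain ⟨h0, h1⟩ := ht t htm
      simp only [step, Prod.smul_mk, smul_eq_mul]
      apply mem_shell_of_bounds hl _ (by linarith) (by linarith) (by linarith) (by linarith)
      rcases hq.2 with h | h | h
      · left; linarith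
      · right; right; left; linarith
      · right; right; right; linarith) (by
      intro q hq
      obtain ⟨⟨hx, hx'⟩, hy, hy'⟩ := hbd q hq.1
      simp only [endpoint, step, basePrism]
      refine ⟨⟨?_, ?_⟩, ?_, ?_⟩ <;> linarith)
  have e₂ := A.lintegral_sq_le_of_path hu hm₂ (measurableSet_shell l) (measurableSet_basePrism l)
    [(0, 4 * l), (4 * l, 0)] (by
      intro q hq
      obtain ⟨⟨hx, hx'⟩, hy, hy'⟩ := hbd q hq.1
      have hq2 : q.1 ≤ -(l / 2) := hq.2
      refine ⟨fun t htm => ?_, fun t htm => ?_, trivial⟩ <;> obtain ⟨h0, h1⟩ := ht t htm <;>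
        simp only [step, Prod.smul_mk, smul_eq_mul] <;>
        apply mem_shell_of_bounds hl _ (by linarith) (by linarith) (by linarith) (by linarith)
      · right; left; linarith
      · right; right; left; linarith) (by
      intro q hq
      obtain ⟨⟨hx, hx'⟩, hy, hy'⟩ := hbd q hq.1
      have hq2 : q.1 ≤ -(l / 2) := hq.2
      simp only [endpoint, step, basePrism]
      refine ⟨⟨?_, ?_⟩, ?_, ?_⟩ <;> linarith)
  have hR := lintegral_basePrism_le hr₀ hB hA hgap hu hl hlr
  set G := ∫⁻ q in shell l, ENNReal.ofReal (A.energyDensity u q) with hG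
  set δ := holonomyGap (B.flux 0) with hδ
  calc _ ≤ ∫⁻ q in S₁ ∪ S₂, ENNReal.ofReal (‖u q‖ ^ 2) := lintegral_mono_set hcov
    _ ≤ (∫⁻ q in S₁, ENNReal.ofReal (‖u q‖ ^ 2)) + ∫⁻ q in S₂, ENNReal.ofReal (‖u q‖ ^ 2) :=
        lintegral_union_le _ _ _
    _ ≤ (2 * (ENNReal.ofReal (32 * l ^ 2) * G) +
          2 * (ENNReal.ofReal (97664 / δ * l ^ 2) * G)) +
        (2 * (ENNReal.ofReal (96 * l ^ 2) * G) +
          2 * (ENNReal.ofReal (97664 / δ * l ^ 2) * G)) := by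
        have c₁ : transportCost [(4 * l, 0)] = 32 * l ^ 2 := by
          simp only [transportCost]; ring
        have c₂ : transportCost [(0, 4 * l), (4 * l, 0)] = 96 * l ^ 2 := by
          simp only [transportCost]; ring
        rw [c₁] at e₁
        rw [c₂] at e₂
        refine add_le_add (e₁.trans ?_) (e₂.trans ?_) <;> gcongr
    _ = _ := by
        -- Origin of the constants: `256 = 2 * 32 + 2 * 96` and `390656 = 4 * 97664`.
        have hs : localHardyConst (B.flux 0) * l ^ 2 = (2 * (32 * l ^ 2) + 2 * (97664 / δ * l ^ 2)) +
            (2 * (96 * l ^ 2) + 2 * (97664 / δ * l ^ 2)) := by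
          rw [localHardyConst, ← hδ]
          ring
        rw [hs, ENNReal.ofReal_add (by positivity) (by positivity),
          ENNReal.ofReal_add (by positivity) (by positivity),
          ENNReal.ofReal_add (by positivity) (by positivity)]
        simp only [ENNReal.ofReal_mul zero_le_two, ENNReal.ofReal_ofNat]
        ring

/-- The segments into `basePrism` may meet the axis, so the energy is taken over the whole space.
This is harmless because a single cylinder is needed. -/
theorem lintegral_cylinder_le (hr₀ : 0 ≤ r₀) (hB : B.SupportedInCylinder r₀)
    (hA : A.IsVectorPotential B) (hgap : 0 < holonomyGap (B.flux 0)) (hu : ContDiff ℝ ∞ u) {l : ℝ}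
    (hl : 0 < l) (hlr : r₀ < l) :
    ∫⁻ q in cylinder l, ENNReal.ofReal (‖u q‖ ^ 2) ≤
      ENNReal.ofReal (localHardyConst (B.flux 0) * l ^ 2) *
        ∫⁻ q, ENNReal.ofReal (A.energyDensity u q) := by
  have e := A.lintegral_sq_le_of_path hu (measurableSet_cylinder l) MeasurableSet.univ
    (measurableSet_basePrism l) [(4 * l, 0)] (fun q _ => ⟨fun _ _ => trivial, trivial⟩) (by
      intro q (hq : q.1 ^ 2 + q.2.1 ^ 2 ≤ l ^ 2)
      have h1 : |q.1| ≤ l := abs_le_of_sq_le_sq (by nlinarith [sq_nonneg q.2.1]) hl.le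
      have h2 : |q.2.1| ≤ l := abs_le_of_sq_le_sq (by nlinarith [sq_nonneg q.1]) hl.le
      rw [abs_le] at h1 h2
      simp only [endpoint, step, basePrism]
      refine ⟨⟨?_, ?_⟩, ?_, ?_⟩ <;> linarith)
  rw [Measure.restrict_univ] at e
  have hR := (lintegral_basePrism_le hr₀ hB hA hgap hu hl hlr).trans
    (mul_le_mul' le_rfl (setLIntegral_le_lintegral _ _))
  set G := ∫⁻ q, ENNReal.ofReal (A.energyDensity u q) with hG
  set δ := holonomyGap (B.flux 0) with hδ
  have c : transportCost [(4 * l, 0)] = 32 * l ^ 2 := by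
    simp only [transportCost]; ring
  rw [c] at e
  calc _ ≤ _ := e
    _ ≤ 2 * (ENNReal.ofReal (32 * l ^ 2) * G) +
          2 * (ENNReal.ofReal (97664 / δ * l ^ 2) * G) := by gcongr
    _ = ENNReal.ofReal (2 * (32 * l ^ 2) + 2 * (97664 / δ * l ^ 2)) * G := by
        rw [ENNReal.ofReal_add (by positivity) (by positivity)]
        simp only [ENNReal.ofReal_mul zero_le_two, ENNReal.ofReal_ofNat]
        ring
    _ ≤ _ := by
        gcongr
        rw [localHardyConst, ← hδ]
        have : 0 ≤ 1 / δ * l ^ 2 := by positivity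
        have h2 := sq_nonneg l
        rw [show 97664 / δ * l ^ 2 = 97664 * (1 / δ * l ^ 2) by ring,
          show (256 + 390656 / δ) * l ^ 2 = 256 * l ^ 2 + 390656 * (1 / δ * l ^ 2) by ring]
        linarith

end HorizontalOneForm

/-! ### Dyadic summation. -/

theorem radius_sq (q : Heisenberg) : radius q ^ 2 = q.1 ^ 2 + q.2.1 ^ 2 :=
  Real.sq_sqrt (by positivity)

/-- A point lies in at most eight of the dyadic shells. -/
theorem tsum_indicator_shell_le {l : ℝ} (hl : 0 < l) (g : Heisenberg → ENNReal) (q : Heisenberg) :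
    ∑' k : ℕ, (shell (2 ^ k * l)).indicator g q ≤ 8 * g q := by
  classical
  by_cases hex : ∃ k : ℕ, q ∈ shell (2 ^ k * l)
  · set m := Nat.find hex with hm
    have hmem : q ∈ shell (2 ^ m * l) := Nat.find_spec hex
    have hout : ∀ k ∉ Finset.Ico m (m + 8), (shell (2 ^ k * l)).indicator g q = 0 := by
      intro k hk
      apply Set.indicator_of_notMem
      intro hkm
      apply hk
      rw [Finset.mem_Ico]
      refine ⟨Nat.find_min' hex hkm, ?_⟩
      by_contra! hlt
      obtain ⟨j, rfl⟩ := Nat.exists_eq_add_of_le hlt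
      have h1 := hkm.1
      have h2 := hmem.2
      have hp : (1 : ℝ) ≤ (2 ^ j) ^ 2 := one_le_pow₀ (one_le_pow₀ one_le_two)
      have hpos : 0 < (2 ^ m * l) ^ 2 := by positivity
      -- The squared radii of a shell have ratio `4 * 10000 = 40000`, less than `4 ^ 8 = 65536`;
      -- hence eight scales.
      rw [show (2 ^ (m + 8 + j) * l) ^ 2 = 65536 * ((2 ^ j) ^ 2 * (2 ^ m * l) ^ 2) by
        rw [pow_add, pow_add]; ring] at h1
      nlinarith [mul_le_mul_of_nonneg_right hp hpos.le]
    rw [tsum_eq_sum hout]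
    calc _ ≤ ∑ _k ∈ Finset.Ico m (m + 8), g q :=
          Finset.sum_le_sum fun k _ => Set.indicator_le_self _ _ q
      _ = 8 * g q := by simp
  · push Not at hex
    simp [Set.indicator_of_notMem (hex _)]

theorem exists_mem_annulus {l : ℝ} (hl : 0 < l) {q : Heisenberg}
    (hq : l ^ 2 < q.1 ^ 2 + q.2.1 ^ 2) : ∃ k : ℕ, q ∈ annulus (2 ^ k * l) := by
  have hr : l ≤ radius q := by
    rw [← abs_of_pos hl]
    exact Real.abs_le_sqrt hq.le
  obtain ⟨k, hk, hk'⟩ := exists_nat_pow_near ((one_le_div hl).2 hr) one_lt_two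
  rw [le_div_iff₀ hl] at hk
  rw [div_lt_iff₀ hl] at hk'
  have h0 : 0 ≤ 2 ^ k * l := by positivity
  refine ⟨k, ?_, ?_⟩
  · rw [← radius_sq]
    exact pow_le_pow_left₀ h0 hk 2
  · rw [← radius_sq]
    have := pow_le_pow_left₀ (h0.trans hk) hk'.le 2
    rw [pow_succ (2 : ℝ) k] at this
    linarith

namespace HorizontalOneForm

variable {A : HorizontalOneForm} {B : MagneticField} {r₀ : ℝ} {u : Heisenberg → ℂ}

/-- The inverse of the constant in the global Hardy inequality. -/
def globalHardyConst (r₀ F : ℝ) : ℝ := localHardyConst F * (r₀ + 1) ^ 2 + 8 * localHardyConst F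

theorem lintegral_hardy_le (hr₀ : 0 ≤ r₀) (hB : B.SupportedInCylinder r₀)
    (hA : A.IsVectorPotential B) (hgap : 0 < holonomyGap (B.flux 0)) (hu : ContDiff ℝ ∞ u) :
    ∫⁻ q, ENNReal.ofReal (1 / (1 + radius q ^ 2) * ‖u q‖ ^ 2) ≤
      ENNReal.ofReal (globalHardyConst r₀ (B.flux 0)) *
        ∫⁻ q, ENNReal.ofReal (A.energyDensity u q) := by
  obtain ⟨l, hl⟩ : ∃ l, l = r₀ + 1 := ⟨_, rfl⟩
  have hl0 : 0 < l := by linarith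
  set K := localHardyConst (B.flux 0) with hK
  have hK0 : 0 ≤ K := by
    rw [hK, localHardyConst]
    positivity
  have hGm : Measurable fun q => ENNReal.ofReal (A.energyDensity u q) :=
    ENNReal.measurable_ofReal.comp (A.continuous_energyDensity hu).measurable
  have hum : Measurable fun q => ENNReal.ofReal (‖u q‖ ^ 2) :=
    ENNReal.measurable_ofReal.comp (hu.continuous.norm.pow 2).measurable
  set a : ℕ → ℝ := fun k => 2 ^ k * l with ha
  have ha0 : ∀ k, 0 < a k := fun k => by positivity
  have har : ∀ k, r₀ < a k := fun k => by
    have : (1 : ℝ) ≤ 2 ^ k := one_le_pow₀ one_le_two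
    nlinarith [mul_le_mul_of_nonneg_right this hl0.le]
  -- The weight is at most `1` on the cylinder and at most `1 / a k ^ 2` on the annulus of scale `a
  -- k`; the latter cancels the factor `l ^ 2` of the local inequality.
  have hpt : ∀ q, ENNReal.ofReal (1 / (1 + radius q ^ 2) * ‖u q‖ ^ 2) ≤
      (cylinder l).indicator (fun q => ENNReal.ofReal (‖u q‖ ^ 2)) q +
        ∑' k, ENNReal.ofReal (1 / a k ^ 2) *
          (annulus (a k)).indicator (fun q => ENNReal.ofReal (‖u q‖ ^ 2)) q := by
    intro q
    by_cases hq : q ∈ cylinder l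
    · refine le_add_right ?_
      rw [Set.indicator_of_mem hq]
      refine ENNReal.ofReal_le_ofReal (mul_le_of_le_one_left (by positivity) ?_)
      rw [div_le_one (by positivity)]
      nlinarith [sq_nonneg (radius q)]
    · obtain ⟨k, hk⟩ := exists_mem_annulus hl0 (not_le.1 hq)
      refine le_add_left (le_trans ?_ (ENNReal.le_tsum k))
      rw [Set.indicator_of_mem hk, ← ENNReal.ofReal_mul (by positivity)]
      refine ENNReal.ofReal_le_ofReal (mul_le_mul_of_nonneg_right ?_ (by positivity))
      refine one_div_le_one_div_of_le (pow_pos (ha0 k) 2) ?_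
      rw [radius_sq]
      linarith [hk.1]
  calc _ ≤ ∫⁻ q, ((cylinder l).indicator (fun q => ENNReal.ofReal (‖u q‖ ^ 2)) q +
        ∑' k, ENNReal.ofReal (1 / a k ^ 2) *
          (annulus (a k)).indicator (fun q => ENNReal.ofReal (‖u q‖ ^ 2)) q) := lintegral_mono hpt
    _ = (∫⁻ q in cylinder l, ENNReal.ofReal (‖u q‖ ^ 2)) + ∑' k, ENNReal.ofReal (1 / a k ^ 2) *
          ∫⁻ q in annulus (a k), ENNReal.ofReal (‖u q‖ ^ 2) := by
        rw [lintegral_add_left (hum.indicator (measurableSet_cylinder l)),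
          lintegral_indicator (measurableSet_cylinder l), lintegral_tsum fun k =>
            ((hum.indicator (measurableSet_annulus (a k))).const_mul _).aemeasurable]
        congr 2
        funext k
        rw [lintegral_const_mul' _ _ ENNReal.ofReal_ne_top,
          lintegral_indicator (measurableSet_annulus (a k))]
    _ ≤ ENNReal.ofReal (K * l ^ 2) * (∫⁻ q, ENNReal.ofReal (A.energyDensity u q)) +
        ∑' k, ENNReal.ofReal K * ∫⁻ q in shell (a k), ENNReal.ofReal (A.energyDensity u q) := by
        refine add_le_add (lintegral_cylinder_le hr₀ hB hA hgap hu hl0 (by linarith)) ?_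
        refine ENNReal.tsum_le_tsum fun k => ?_
        refine (mul_le_mul' le_rfl
          (lintegral_annulus_le hr₀ hB hA hgap hu (ha0 k) (har k))).trans_eq ?_
        rw [← mul_assoc, ← ENNReal.ofReal_mul (by positivity)]
        have := (ha0 k).ne'
        congr 2
        field_simp
        rfl
    _ ≤ ENNReal.ofReal (K * l ^ 2) * (∫⁻ q, ENNReal.ofReal (A.energyDensity u q)) +
        ENNReal.ofReal K * (8 * ∫⁻ q, ENNReal.ofReal (A.energyDensity u q)) := by
        rw [ENNReal.tsum_mul_left]
        gcongr
        simp only [← lintegral_indicator (measurableSet_shell _)]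
        rw [← lintegral_tsum fun k => (hGm.indicator (measurableSet_shell (a k))).aemeasurable,
          ← lintegral_const_mul' _ _ ENNReal.ofNat_ne_top]
        exact lintegral_mono fun q => tsum_indicator_shell_le hl0 _ q
    _ = _ := by
        rw [globalHardyConst, ← hK, ← hl, ENNReal.ofReal_add (by positivity) (by positivity),
          ENNReal.ofReal_mul (p := 8) (by norm_num), ENNReal.ofReal_ofNat]
        ring

theorem integrable_energyDensity (A : HorizontalOneForm) (hu : IsTestFunction u) :
    Integrable (A.energyDensity u) := by
  refine (A.continuous_energyDensity hu.1).integrable_of_hasCompactSupport ?_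
  refine HasCompactSupport.intro (K := tsupport u) hu.2 fun q hq => ?_
  have h := notMem_tsupport_iff_eventuallyEq.1 hq
  simp [energyDensity, covX, covY, h.fderiv_eq, h.self_of_nhds]

theorem energy_nonneg (A : HorizontalOneForm) (u : Heisenberg → ℂ) : 0 ≤ A.energy u :=
  integral_nonneg fun q => A.energyDensity_nonneg u q

theorem lintegral_energyDensity (A : HorizontalOneForm) (hu : IsTestFunction u) :
    ∫⁻ q, ENNReal.ofReal (A.energyDensity u q) = ENNReal.ofReal (A.energy u) :=
  (ofReal_integral_eq_lintegral_ofReal (A.integrable_energyDensity hu)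
    (Eventually.of_forall (A.energyDensity_nonneg u))).symm

end HorizontalOneForm

/-! ### Passage to the closed form, and conclusion. -/

theorem sq_eLpNorm_two {α : Type*} [MeasurableSpace α] (μ : Measure α) (f : α → ℂ) :
    eLpNorm f 2 μ ^ 2 = ∫⁻ q, ENNReal.ofReal (‖f q‖ ^ 2) ∂μ := by
  have h := eLpNorm_nnreal_pow_eq_lintegral (f := f) (μ := μ) (p := 2) two_ne_zero
  simp only [NNReal.coe_ofNat, ENNReal.rpow_ofNat, ENNReal.coe_ofNat] at h
  rw [h]
  simp only [ENNReal.ofReal_pow (norm_nonneg _), ofReal_norm]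

/-- A form inequality on test functions, with a bounded continuous weight, passes to the closure. -/
theorem HorizontalOneForm.laplacianGE_of_test {A : HorizontalOneForm} {w : Heisenberg → ℝ}
    (hw : Continuous w) (hw0 : ∀ q, 0 ≤ w q) (hw1 : ∀ q, w q ≤ 1)
    (h : ∀ u, IsTestFunction u → ∫⁻ q, ENNReal.ofReal (w q * ‖u q‖ ^ 2) ≤
      ENNReal.ofReal (A.energy u)) : A.LaplacianGE w := by
  rintro u E ⟨hu, φ, hφ, hφu, -, hE⟩
  set s : Heisenberg → ℂ := fun q => (Real.sqrt (w q) : ℂ) with hs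
  have hsc : Continuous s := by fun_prop
  have hsn : ∀ (f : Heisenberg → ℂ) q, ‖(s * f) q‖ ^ 2 = w q * ‖f q‖ ^ 2 := by
    intro f q
    simp only [Pi.mul_apply, norm_mul, mul_pow, hs, Complex.norm_real, Real.norm_eq_abs, sq_abs,
      Real.sq_sqrt (hw0 q)]
  -- Multiplication by `√w` is a contraction of `L²`, so `L²` convergence of the test functions
  -- survives the weight and the bound passes to the limit.
  have hs1 : ∀ f : Heisenberg → ℂ, eLpNorm (s * f) 2 volume ≤ eLpNorm f 2 volume := by
    intro f
    refine eLpNorm_mono fun q => ?_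
    refine le_of_sq_le_sq ?_ (norm_nonneg _)
    rw [hsn]
    exact mul_le_of_le_one_left (by positivity) (hw1 q)
  have hE0 : 0 ≤ E := ge_of_tendsto' hE fun n => A.energy_nonneg _
  have hmeas : AEStronglyMeasurable u volume := hu.1
  have hbound : ∀ n, eLpNorm (s * u) 2 volume ≤
      eLpNorm (φ n - u) 2 volume + ENNReal.ofReal (A.energy (φ n)) ^ (1 / 2 : ℝ) := by
    intro n
    have hφm : AEStronglyMeasurable (φ n) volume := (hφ n).1.continuous.aestronglyMeasurable
    have h1 : eLpNorm (s * φ n) 2 volume ≤ ENNReal.ofReal (A.energy (φ n)) ^ (1 / 2 : ℝ) := by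
      have h2 := h _ (hφ n)
      simp only [← hsn] at h2
      rw [← sq_eLpNorm_two] at h2
      have h3 := ENNReal.rpow_le_rpow h2 (show (0 : ℝ) ≤ 1 / 2 by norm_num)
      rw [← ENNReal.rpow_natCast, ← ENNReal.rpow_mul] at h3
      simpa using h3
    calc eLpNorm (s * u) 2 volume = eLpNorm (s * φ n - s * (φ n - u)) 2 volume := by
          congr 1
          ring
      _ ≤ eLpNorm (s * φ n) 2 volume + eLpNorm (s * (φ n - u)) 2 volume :=
          eLpNorm_sub_le (hsc.aestronglyMeasurable.mul hφm)
            (hsc.aestronglyMeasurable.mul (hφm.sub hmeas)) one_le_two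
      _ ≤ _ := by
          rw [add_comm]
          exact add_le_add (hs1 _) h1
  have hlim : Tendsto (fun n => eLpNorm (φ n - u) 2 volume +
      ENNReal.ofReal (A.energy (φ n)) ^ (1 / 2 : ℝ)) atTop
      (𝓝 (0 + ENNReal.ofReal E ^ (1 / 2 : ℝ))) :=
    hφu.add ((ENNReal.continuous_rpow_const.tendsto _).comp
      ((ENNReal.continuous_ofReal.tendsto E).comp hE))
  have hfin := ge_of_tendsto' hlim hbound
  rw [zero_add] at hfin
  have hlint : ∫⁻ q, ENNReal.ofReal (w q * ‖u q‖ ^ 2) ≤ ENNReal.ofReal E := by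
    have h2 := pow_le_pow_left₀ zero_le hfin 2
    rw [sq_eLpNorm_two, ← ENNReal.rpow_natCast, ← ENNReal.rpow_mul] at h2
    simp only [hsn] at h2
    simpa using h2
  have hm : AEStronglyMeasurable (fun q => w q * ‖u q‖ ^ 2) volume :=
    hw.aestronglyMeasurable.mul (hmeas.norm.pow 2)
  have hnn : ∀ q, 0 ≤ w q * ‖u q‖ ^ 2 := fun q => mul_nonneg (hw0 q) (by positivity)
  have hint : Integrable (fun q => w q * ‖u q‖ ^ 2) := by
    refine ⟨hm, ?_⟩
    rw [hasFiniteIntegral_iff_ofReal (Eventually.of_forall hnn)]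
    exact hlint.trans_lt ENNReal.ofReal_lt_top
  refine ⟨hint, ?_⟩
  rw [← ENNReal.ofReal_le_ofReal_iff hE0,
    ofReal_integral_eq_lintegral_ofReal hint (Eventually.of_forall hnn)]
  exact hlint

end Heisenberg

end

theorem theorem2p6 (B : Heisenberg.MagneticField) (r₀ : ℝ) (hr₀ : 0 < r₀)
    (hB : B.SupportedInCylinder r₀) :
    (∀ z : ℝ, Integrable (fun ξ : ℝ × ℝ => B.primitive (ξ.1, ξ.2, z))) ∧
    ∃ F : ℝ, (∀ z : ℝ, B.flux z = F) ∧
      ((∀ n : ℤ, F ≠ (n : ℝ)) →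
        ∃ c : ℝ, 0 < c ∧
          ∀ A : Heisenberg.HorizontalOneForm, A.IsVectorPotential B →
            A.LaplacianGE (fun q => c / (1 + Heisenberg.radius q ^ 2))) := by
  refine ⟨hB.integrable_primitive hr₀.le, B.flux 0, fun z => ?_, fun hF => ?_⟩
  · have h1 := hB.flux_eq hr₀.le z
    rw [hB.integral_radialMoment_eq hr₀.le z 0, ← hB.flux_eq hr₀.le 0] at h1
    exact mul_left_cancel₀ (by positivity) h1
  have hgap := Heisenberg.HorizontalOneForm.holonomyGap_pos hF
  set M := Heisenberg.HorizontalOneForm.globalHardyConst r₀ (B.flux 0) with hM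
  -- Ensures that the weight `(1 / M) / (1 + r²)` is at most `1`, as `laplacianGE_of_test` requires.
  have hM1 : 1 ≤ M := by
    have hK : 256 ≤ Heisenberg.HorizontalOneForm.localHardyConst (B.flux 0) :=
      le_add_of_nonneg_right (by positivity)
    rw [hM, Heisenberg.HorizontalOneForm.globalHardyConst]
    nlinarith [mul_nonneg (show 0 ≤ Heisenberg.HorizontalOneForm.localHardyConst (B.flux 0) by
      linarith) (sq_nonneg (r₀ + 1))]
  have hM0 : 0 < M := by linarith
  refine ⟨1 / M, by positivity, fun A hA => ?_⟩
  have hr : Continuous Heisenberg.radius := by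
    unfold Heisenberg.radius
    fun_prop
  refine Heisenberg.HorizontalOneForm.laplacianGE_of_test ?_ (fun q => by positivity)
    (fun q => ?_) fun u hu => ?_
  · exact continuous_const.div (by fun_prop) fun q => by positivity
  · rw [div_le_one (by positivity)]
    have : 1 / M ≤ 1 := (div_le_one hM0).2 hM1
    nlinarith [sq_nonneg (Heisenberg.radius q)]
  · have h := Heisenberg.HorizontalOneForm.lintegral_hardy_le hr₀.le hB hA hgap hu.1
    rw [A.lintegral_energyDensity hu, ← hM] at h
    calc _ = ENNReal.ofReal (1 / M) *
          ∫⁻ q, ENNReal.ofReal (1 / (1 + Heisenberg.radius q ^ 2) * ‖u q‖ ^ 2) := by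
          rw [← lintegral_const_mul' _ _ ENNReal.ofReal_ne_top]
          congr 1
          funext q
          rw [← ENNReal.ofReal_mul (by positivity)]
          congr 1
          ring
      _ ≤ ENNReal.ofReal (1 / M) * (ENNReal.ofReal M * ENNReal.ofReal (A.energy u)) := by gcongr
      _ = _ := by
          rw [← mul_assoc, ← ENNReal.ofReal_mul (by positivity), one_div_mul_cancel hM0.ne']
          simp
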